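/- Let $d\ge 1$ and let $\mathcal D\subset\mathbb R^d$ be open. Let $$K(x,y)=L(x,y)+\log\frac1{|x-y|},\qquad x,y\in\mathcal D,$$ where $L:\mathcal D^2\to\mathbb R$ is continuous and $L\in H^s_{\mathrm{loc}}(\mathcal D^2)$ for some $s>d$ (that is, $\varphi L\in H^s(\mathbb R^{2d})$ for every $\varphi\in C_c^\infty(\mathcal D^2)$), and assume that $K$ is positive definite: $\int_{\mathcal D^2}K(x,y)f(x)f(y)\,dx\,dy\ge 0$ for every continuous $f$ with compact support in $\mathcal D$. Let $\mathcal M_K$ be the set of differences of two finite positive Borel measures $\mu$ on $\mathcal D$ with $\int_{\mathcal D^2}|K(x,y)|\,\mu(dx)\mu(dy)<\infty$ (where $|K(x,x)|=\infty$), and let $X=(\langle X,\mu\rangle)_{\mu\in\mathcal M_K}$ be a centered Gaussian field with covariance $\mathbb E[\langle X,\mu\rangle\langle X,\mu'\rangle]=\int_{\mathcal D^2} K(x,y)\,\mu(dx)\mu'(dy)$ (whenever this integral converges absolutely). Let $\theta\ge 0$ be a $C^\infty$ function on $\mathbb R^d$ supported in the unit ball with $\int\theta=1$, let $\theta_\varepsilon=\varepsilon^{-d}\theta(\varepsilon^{-1}\cdot)$,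 and let $\mathcal D_\varepsilon$ be the set of the points of $\mathcal D$ at distance at least $2\varepsilon$ from $\mathbb R^d\setminus\mathcal D$. Let $(X_\varepsilon(x))_{x\in\mathcal D_\varepsilon}$ be a version, continuous in $x$, of $x\mapsto\langle X,\theta_\varepsilon(x-\cdot)\rangle$, and let $K_\varepsilon(x)=\int\int\theta_\varepsilon(x-z_1)\theta_\varepsilon(x-z_2)K(z_1,z_2)\,dz_1\,dz_2$. For $\gamma\in\mathbb C$ let $$M_\varepsilon^{(\gamma)}(f)=\int_{\mathcal D_\varepsilon}f(x)\,e^{\gamma X_\varepsilon(x)-\frac{\gamma^2}2K_\varepsilon(x)}\,dx .$$ Assume that $\gamma=\alpha+i\beta$ with $|\alpha|<\sqrt{d/2}$ and $\alpha^2+\beta^2\ge d$, let $\ell_\theta(z)=\int\int\log\frac1{|z+z_1-z_2|}\theta(z_1)\theta(z_2)\,dz_1\,dz_2$, and set $$v(\varepsilon,\theta,\gamma)=\begin{cases}\varepsilon^{\frac{|\gamma|^2-d}2}\Big(\frac12\int_{\mathbb R^d}e^{|\gamma|^2\ell_\theta(z)}\,dz\Big)^{-1/2}&\text{if }|\gamma|>\sqrt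 d,\\[1ex]\Big(\frac{\pi^{d/2}}{\Gamma(d/2)}\log\frac1\varepsilon\Big)^{-1/2}&\text{if }|\gamma|=\sqrt d.\end{cases}$$ Let $\rho\in C_c^\infty(\mathcal D)$ be real-valued and let $u>d/2$. Then, for each $\varepsilon\in(0,1)$, the distribution $\varphi\mapsto v(\varepsilon,\theta,\gamma)\,M_\varepsilon^{(\gamma)}(\rho\,\varphi)$ is (almost surely) a random element of the Sobolev space $H^{-u}(\mathbb R^d)$. The family of these random elements with $\varepsilon\in(0,1)$ is tight in $H^{-u}(\mathbb R^d)$ if $|\gamma|>\sqrt d$. In all cases, including $|\gamma|=\sqrt d$, the family with $\varepsilon\in(0,\varepsilon_0)$ is tight in $H^{-u}(\mathbb R^d)$ for every $\varepsilon_0\in(0,1)$. -/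

import Mathlib

open MeasureTheory ProbabilityTheory TemperedDistribution Set Filter Topology
open scoped SchwartzMap ENNReal

noncomputable section

namespace ComplexGMC

/-! ### Sobolev spaces -/

section Sobolev

variable {V : Type*} [NormedAddCommGroup V] [InnerProductSpace ℝ V] [FiniteDimensional ℝ V]
  [MeasurableSpace V] [BorelSpace V]

variable (V) in
/-- The tempered distributions `T` on `V` with `(1 + |ξ|²)^{s/2} 𝓕 T ∈ L²`. -/
def sobolevSubmodule (s : ℝ) : Submodule ℂ 𝓢'(V, ℂ) where
  carrier := {T | MemSobolev s 2 T}
  add_mem' := fun ha hb => ha.add hb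
  zero_mem' := memSobolev_fun_zero V ℂ s 2
  smul_mem' := fun c _ h => h.smul c

variable (V) in
/-- The Sobolev space `H^s(V)`. It is a type synonym because it carries the topology of the Sobolev
norm (defined below) and not the one induced by the space of tempered distributions. -/
def SobolevSpace (s : ℝ) : Type _ := ↥(sobolevSubmodule V s)

namespace SobolevSpace

variable {s : ℝ}

instance : AddCommGroup (SobolevSpace V s) := inferInstanceAs (AddCommGroup ↥(sobolevSubmodule V s))

instance : Module ℂ (SobolevSpace V s) := inferInstanceAs (Module ℂ ↥(sobolevSubmodule V s))

/-- The tempered distribution underlying an element of `H^s`. -/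
def toDistribution : SobolevSpace V s →ₗ[ℂ] 𝓢'(V, ℂ) := (sobolevSubmodule V s).subtype

theorem toDistribution_injective :
    Function.Injective (toDistribution : SobolevSpace V s →ₗ[ℂ] 𝓢'(V, ℂ)) :=
  Subtype.val_injective

theorem memSobolev (T : SobolevSpace V s) : MemSobolev s 2 T.toDistribution := T.2

theorem lp_toTemperedDistribution_injective :
    Function.Injective
      (Lp.toTemperedDistributionCLM ℂ (volume : Measure V) 2) :=
  LinearMap.ker_eq_bot.1 Lp.ker_toTemperedDistributionCLM_eq_bot

/-- The `L²` function representing `𝓕⁻¹ (1 + |ξ|²)^{s/2} 𝓕 T`. -/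
def toL2Fun (T : SobolevSpace V s) : Lp ℂ 2 (volume : Measure V) := T.memSobolev.choose

theorem toL2Fun_spec (T : SobolevSpace V s) :
    besselPotential V ℂ s T.toDistribution =
      Lp.toTemperedDistributionCLM ℂ (volume : Measure V) 2 T.toL2Fun :=
  T.memSobolev.choose_spec

/-- The isometry `T ↦ 𝓕⁻¹ (1 + |ξ|²)^{s/2} 𝓕 T` from `H^s` to `L²`. -/
def toL2 : SobolevSpace V s →ₗ[ℂ] Lp ℂ 2 (volume : Measure V) where
  toFun := toL2Fun
  map_add' a b := by
    apply lp_toTemperedDistribution_injective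
    rw [map_add, ← toL2Fun_spec, ← toL2Fun_spec, ← toL2Fun_spec, map_add, map_add]
  map_smul' c a := by
    apply lp_toTemperedDistribution_injective
    rw [map_smul, ← toL2Fun_spec, ← toL2Fun_spec, map_smul, map_smul, RingHom.id_apply]

theorem toL2_injective :
    Function.Injective (toL2 : SobolevSpace V s →ₗ[ℂ] Lp ℂ 2 (volume : Measure V)) := by
  intro a b h
  have h1 := toL2Fun_spec a
  rw [show a.toL2Fun = b.toL2Fun from h, ← toL2Fun_spec] at h1
  apply toDistribution_injective
  have h2 := congrArg (besselPotential V ℂ (-s)) h1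
  simpa using h2

/-- The norm of `H^s`: `‖T‖² = ∫ (1 + |ξ|²)^s |𝓕 T(ξ)|² dξ` by Plancherel. Here `𝓕` is the Fourier
transform with kernel `e^{-2πi⟨x, ξ⟩}`; the kernel `e^{i⟨x, ξ⟩}` gives an equivalent norm. -/
instance : NormedAddCommGroup (SobolevSpace V s) :=
  NormedAddCommGroup.induced (SobolevSpace V s) (Lp ℂ 2 (volume : Measure V)) toL2 toL2_injective

instance : NormedSpace ℂ (SobolevSpace V s) :=
  NormedSpace.induced ℂ (SobolevSpace V s) (Lp ℂ 2 (volume : Measure V)) toL2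

instance : MeasurableSpace (SobolevSpace V s) := borel _

instance : BorelSpace (SobolevSpace V s) := ⟨rfl⟩

end SobolevSpace

/-- `f` is a real-valued smooth function whose support is compact and included in `U`. -/
def IsTestFunction (U : Set V) (f : V → ℝ) : Prop :=
  ContDiff ℝ (⊤ : ℕ∞) f ∧ HasCompactSupport f ∧ tsupport f ⊆ U

/-- The function `φ : U → ℝ` belongs to `H^s_loc(U)`, where `s ≥ 0`: for every `ρ ∈ C_c^∞(U)` the
extension by zero of `ρ φ` is (almost everywhere equal to) an element of `H^s(V)`. -/
def MemSobolevLoc (s : ℝ) (U : Set V) (φ : V → ℝ) : Prop :=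
  ∀ ρ : V → ℝ, IsTestFunction U ρ →
    ∃ f : Lp ℂ 2 (volume : Measure V),
      (∀ᵐ x, f x = ((ρ x * φ x : ℝ) : ℂ)) ∧ MemSobolev s 2 (Lp.toTemperedDistribution f)

end Sobolev

/-! ### Log-correlated fields -/

/-- The Euclidean space `ℝ^d`. -/
abbrev Eucl (d : ℕ) : Type := EuclideanSpace ℝ (Fin d)

variable {d : ℕ}

/-- The kernel `K(x, y) = L(x, y) + log (1 / |x - y|)`, for `x ≠ y`. Its value on the diagonal
should be `∞` and is irrelevant here: the diagonal is a null set for every product measure that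
is used below. -/
def logKernel (L : Eucl d → Eucl d → ℝ) (x y : Eucl d) : ℝ :=
  L x y + Real.log (1 / ‖x - y‖)

open Classical in
/-- `|K(x, y)|`, with the value `∞` on the diagonal. -/
def absLogKernel (L : Eucl d → Eucl d → ℝ) (x y : Eucl d) : ℝ≥0∞ :=
  if x = y then ⊤ else ENNReal.ofReal |logKernel L x y|

/-- `K(x, y) = L(x, y) + log (1 / |x - y|)` is a positive definite kernel on `D`, with `L`
continuous on `D × D`. -/
structure IsLogCorrelatedKernel (D : Set (Eucl d)) (L : Eucl d → Eucl d → ℝ) : Prop where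
  continuousOn : ContinuousOn (Function.uncurry L) (D ×ˢ D)
  posDef : ∀ f : Eucl d → ℝ, Continuous f → HasCompactSupport f → tsupport f ⊆ D →
    0 ≤ ∫ z : Eucl d × Eucl d, logKernel L z.1 z.2 * f z.1 * f z.2

/-- The (finite) positive Borel measures `μ` on `D` with `∫ |K(x, y)| μ(dx) μ(dy) < ∞`. A measure on
`D` is seen as a measure on `ℝ^d` which gives no mass to the complement of `D`. -/
def posFiniteEnergy (D : Set (Eucl d)) (L : Eucl d → Eucl d → ℝ) : Set (Measure (Eucl d)) :=
  {μ | IsFiniteMeasure μ ∧ μ Dᶜ = 0 ∧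
    ∫⁻ z : Eucl d × Eucl d, absLogKernel L z.1 z.2 ∂(μ.prod μ) < ⊤}

/-- The space `𝓜_K` of the signed measures `μ₊ - μ₋` with `μ₊, μ₋ ∈ 𝓜_K⁺`. -/
def finiteEnergy (D : Set (Eucl d)) (L : Eucl d → Eucl d → ℝ) : Set (SignedMeasure (Eucl d)) :=
  {ν | ∃ (μ₁ μ₂ : Measure (Eucl d)) (_ : IsFiniteMeasure μ₁) (_ : IsFiniteMeasure μ₂),
    μ₁ ∈ posFiniteEnergy D L ∧ μ₂ ∈ posFiniteEnergy D L ∧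
      ν = μ₁.toSignedMeasure - μ₂.toSignedMeasure}

/-- The integral `∫ k(x, y) ν(dx) ν'(dy)` for signed measures `ν, ν'`. -/
def doubleIntegral (k : Eucl d → Eucl d → ℝ) (ν ν' : SignedMeasure (Eucl d)) : ℝ :=
  let p := ν.toJordanDecomposition.posPart
  let n := ν.toJordanDecomposition.negPart
  let p' := ν'.toJordanDecomposition.posPart
  let n' := ν'.toJordanDecomposition.negPart
  (∫ z : Eucl d × Eucl d, k z.1 z.2 ∂(p.prod p')) - (∫ z : Eucl d × Eucl d, k z.1 z.2 ∂(p.prod n'))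
    - (∫ z : Eucl d × Eucl d, k z.1 z.2 ∂(n.prod p'))
    + (∫ z : Eucl d × Eucl d, k z.1 z.2 ∂(n.prod n'))

/-- `X = (⟨X, ν⟩)_{ν ∈ 𝓜_K}` is a centered Gaussian field whose covariance is
`E[⟨X, ν⟩⟨X, ν'⟩] = ∫ K(x, y) ν(dx) ν'(dy)` for all `ν, ν' ∈ 𝓜_K` for which this integral converges
absolutely. -/
structure IsLogCorrelatedField {Ω : Type*} [MeasurableSpace Ω] (P : Measure Ω)
    (D : Set (Eucl d)) (L : Eucl d → Eucl d → ℝ) (X : SignedMeasure (Eucl d) → Ω → ℝ) : Prop where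
  isGaussianProcess : IsGaussianProcess (fun ν : finiteEnergy D L => X ν) P
  centered : ∀ ν ∈ finiteEnergy D L, ∫ w, X ν w ∂P = 0
  covariance : ∀ ν ∈ finiteEnergy D L, ∀ ν' ∈ finiteEnergy D L,
    Integrable (Function.uncurry (logKernel L)) (ν.totalVariation.prod ν'.totalVariation) →
      ∫ w, X ν w * X ν' w ∂P = doubleIntegral (logKernel L) ν ν'

/-! ### Approximation by convolution -/

/-- A nonnegative smooth function supported in the unit ball and with integral one. -/
structure IsMollifier (θ : Eucl d → ℝ) : Prop where
  contDiff : ContDiff ℝ (⊤ : ℕ∞) θ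
  nonneg : ∀ x, 0 ≤ θ x
  tsupport_subset : tsupport θ ⊆ Metric.closedBall 0 1
  integral_eq_one : ∫ x, θ x = 1

/-- `θ_ε = ε^{-d} θ(ε^{-1} ·)`. -/
def scaled (θ : Eucl d → ℝ) (ε : ℝ) (x : Eucl d) : ℝ := (ε ^ d)⁻¹ * θ (ε⁻¹ • x)

/-- `D_ε`, the set of the points of `D` at distance at least `2ε` from the complement of `D`. -/
def innerDomain (D : Set (Eucl d)) (ε : ℝ) : Set (Eucl d) :=
  {x | x ∈ D ∧ ∀ y ∉ D, 2 * ε ≤ ‖x - y‖}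

/-- The measure `θ_ε(x - y) dy`. -/
def mollifierMeasure (θ : Eucl d → ℝ) (ε : ℝ) (x : Eucl d) : SignedMeasure (Eucl d) :=
  (volume : Measure (Eucl d)).withDensityᵥ (fun y => scaled θ ε (x - y))

/-- For `ε ∈ (0, 1)`, `(Xc ε x)_{x ∈ D_ε}` is a version of the field `X_ε(x) = ⟨X, θ_ε(x - ·)⟩`
which is continuous in `x`. -/
structure IsContinuousConvolution {Ω : Type*} [MeasurableSpace Ω] (P : Measure Ω)
    (D : Set (Eucl d)) (X : SignedMeasure (Eucl d) → Ω → ℝ) (θ : Eucl d → ℝ)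
    (Xc : ℝ → Eucl d → Ω → ℝ) : Prop where
  version : ∀ ε ∈ Ioo (0 : ℝ) 1, ∀ x ∈ innerDomain D ε, Xc ε x =ᵐ[P] X (mollifierMeasure θ ε x)
  continuousOn : ∀ ε ∈ Ioo (0 : ℝ) 1, ∀ᵐ w ∂P, ContinuousOn (fun x => Xc ε x w) (innerDomain D ε)

/-- `K_ε(x, y) = ∫ θ_ε(x - z₁) θ_ε(y - z₂) K(z₁, z₂) dz₁ dz₂`. -/
def mollifiedKernel (L : Eucl d → Eucl d → ℝ) (θ : Eucl d → ℝ) (ε : ℝ) (x y : Eucl d) : ℝ :=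
  ∫ z : Eucl d × Eucl d, scaled θ ε (x - z.1) * scaled θ ε (y - z.2) * logKernel L z.1 z.2

/-- `M_ε^{(γ)}(f) = ∫_{D_ε} f(x) exp(γ X_ε(x) - γ² K_ε(x, x) / 2) dx`, given a realization `Xε` of
the field `X_ε`, for complex-valued `f`. -/
def gmc (D : Set (Eucl d)) (L : Eucl d → Eucl d → ℝ) (θ : Eucl d → ℝ) (γ : ℂ) (ε : ℝ)
    (Xε : Eucl d → ℝ) (f : Eucl d → ℂ) : ℂ :=
  ∫ x in innerDomain D ε,
    f x * Complex.exp (γ * (Xε x : ℂ) - γ ^ 2 / 2 * (mollifiedKernel L θ ε x x : ℂ))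

/-- `ℓ_θ(z) = ∫ log (1 / |z + z₁ - z₂|) θ(z₁) θ(z₂) dz₁ dz₂`. -/
def ellTheta (θ : Eucl d → ℝ) (z : Eucl d) : ℝ :=
  ∫ w : Eucl d × Eucl d, Real.log (1 / ‖z + w.1 - w.2‖) * θ w.1 * θ w.2

/-- The normalization `v(ε, θ, γ)`, for `|γ| ≥ √d`. The last case is the one of `|γ| = √d`. -/
def normalization (θ : Eucl d → ℝ) (γ : ℂ) (ε : ℝ) : ℝ :=
  if Real.sqrt d < ‖γ‖ then
    ε ^ ((‖γ‖ ^ 2 - d) / 2) *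
      ((1 / 2) * ∫ z : Eucl d, Real.exp (‖γ‖ ^ 2 * ellTheta θ z)) ^ (-(1 / 2) : ℝ)
  else
    (Real.pi ^ ((d : ℝ) / 2) / Real.Gamma ((d : ℝ) / 2) * Real.log (1 / ε)) ^ (-(1 / 2) : ℝ)

end ComplexGMC

end

/-! The proof is a second-moment argument. For the mollified Gaussian field, the factor `exp (-γ²
K_ε(x, x) / 2)` cancels the diagonal terms of the exponential moment, so the correlation of the
chaos density at `x` with its conjugate at `y` is exactly `exp (|γ|² K_ε(x, y))`
(`IsContinuousConvolution.two_point`). As `L` is bounded on compact sets and the mollified logarithm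
is at most `log (1 / max (ε, |x - y|))` up to a constant, this is at most a constant times `max (ε,
|x - y|)^{-|γ|²}` on the support of `ρ` (`exists_mollifiedKernel_le`).

The integral of that kernel over a ball is at most of order `ε^{d - |γ|²}` if `|γ|² > d` and `log (1
/ ε)` if `|γ|² = d`, and the square of the normalization has the inverse order
(`exists_normalization_sq_mul_le`). Schur's test (`lintegral_mul_truncKernel_le`) then bounds `E |v
M_ε(ρ f)|²` by `C ∫ |ρ|² |f|²`, uniformly in `ε`: the normalized chaos is no rougher, in second
moment, than white noise of intensity `|ρ|²`.

Such a bound gives tightness in `H^{-u}` for `u > d / 2`, because `(1 + |ξ|²)^{-u/2}` is then square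
integrable. The coordinates of the chaos in a Hilbert basis are its integrals against functions
`h_i` with `∑ |h_i(x)|²` bounded uniformly in `x` (`tsum_enorm_besselSynthesis_sq_le`). Their second
moments are therefore dominated by one summable family, which is a tightness criterion in Hilbert
space (`isTightMeasureSet_of_lintegral_inner_sq_le`).

For fixed `ε` the density is almost surely in `L²`, so the random distribution is the image of a
random element of `L²`. Its measurability comes from the continuity of the paths
(`exists_measurable_modification`). -/

noncomputable section

namespace ComplexGMC

/-! ### A tightness criterion in Hilbert spaces -/

section Tightness

/-- A Hilbert basis of a separable space is countable. -/
theorem _root_.HilbertBasis.countable_index {ι 𝕜 H : Type*} [RCLike 𝕜] [NormedAddCommGroup H]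
    [InnerProductSpace 𝕜 H] [TopologicalSpace.SeparableSpace H] (b : HilbertBasis ι 𝕜 H) :
    Countable ι := by
  -- Distinct basis vectors are at distance `√2`, so the balls of radius `1 / 2` around them are
  -- disjoint open sets.
  have hd : ∀ i j, i ≠ j → 1 ≤ dist (b i) (b j) := by
    intro i j hij
    have h0 : inner 𝕜 (b i) (b j) = 0 := b.orthonormal.2 hij
    have h1 : ‖b i - b j‖ * ‖b i - b j‖ = ‖b i‖ * ‖b i‖ + ‖b j‖ * ‖b j‖ := by
      have := norm_add_sq_eq_norm_sq_add_norm_sq_of_inner_eq_zero (𝕜 := 𝕜) (b i) (-b j)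
        (by simpa using h0)
      simpa [sub_eq_add_neg] using this
    rw [b.orthonormal.1 i, b.orthonormal.1 j] at h1
    rw [dist_eq_norm]
    nlinarith [norm_nonneg (b i - b j)]
  have := Set.PairwiseDisjoint.countable_of_isOpen (s := fun i => Metric.ball (b i) (1 / 2))
    (a := Set.univ) (fun i _ j _ hij => Metric.ball_disjoint_ball (by
      have := hd i j hij; linarith)) (fun i _ => Metric.isOpen_ball)
    (fun i _ => ⟨b i, Metric.mem_ball_self (by norm_num)⟩)
  exact Set.countable_univ_iff.1 this

variable {𝕜 H ι : Type*} [RCLike 𝕜] [NormedAddCommGroup H] [InnerProductSpace 𝕜 H]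

/-- The partial sums of the expansion of a vector in a Hilbert basis. -/
def basisProj (b : HilbertBasis ι 𝕜 H) (s : Finset ι) (x : H) : H :=
  ∑ i ∈ s, inner 𝕜 (b i) x • b i

theorem continuous_basisProj (b : HilbertBasis ι 𝕜 H) (s : Finset ι) :
    Continuous (basisProj b s) := by
  unfold basisProj
  fun_prop

theorem totallyBounded_basisProj_closedBall (b : HilbertBasis ι 𝕜 H) (s : Finset ι) (R : ℝ) :
    TotallyBounded (basisProj b s '' Metric.closedBall 0 R) := by
  have hK : IsCompact ((fun c : s → 𝕜 => ∑ i, c i • b i) '' Metric.closedBall 0 R) :=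
    (isCompact_closedBall _ _).image (by fun_prop)
  refine hK.totallyBounded.subset ?_
  rintro _ ⟨x, hx, rfl⟩
  have hR : 0 ≤ R := (norm_nonneg x).trans (by simpa using hx)
  refine ⟨fun i => inner 𝕜 (b i) x, ?_, ?_⟩
  · rw [mem_closedBall_zero_iff, pi_norm_le_iff_of_nonneg hR]
    intro i
    refine (norm_inner_le_norm _ _).trans ?_
    rw [b.orthonormal.1, one_mul]
    simpa using hx
  · simp only [basisProj]
    exact Finset.sum_coe_sort s (fun i => inner 𝕜 (b i) x • b i)

/-- Bounded sets on which the expansion in a Hilbert basis converges uniformly are relatively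
compact. -/
theorem isCompact_of_basisProj [CompleteSpace H] (b : HilbertBasis ι 𝕜 H) (s : ℕ → Finset ι)
    (R : ℝ) (η : ℕ → ℝ) (hη : Tendsto η atTop (𝓝 0)) :
    IsCompact {x : H | ‖x‖ ≤ R ∧ ∀ k, ‖x - basisProj b (s k) x‖ ≤ η k} := by
  rw [isCompact_iff_totallyBounded_isComplete]
  constructor
  · rw [Metric.totallyBounded_iff]
    intro ε hε
    -- Half of `ε` pays for replacing `x` by its `k`-th projection, the other half for a finite net
    -- of the projections, which lie in a finite-dimensional ball.
    obtain ⟨k, hk⟩ := ((tendsto_order.1 hη).2 (ε / 2) (half_pos hε)).exists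
    obtain ⟨t, ht, hst⟩ := Metric.totallyBounded_iff.1
      (totallyBounded_basisProj_closedBall b (s k) R) (ε / 2) (half_pos hε)
    refine ⟨t, ht, fun x hx => ?_⟩
    have := hst ⟨x, by simpa using hx.1, rfl⟩
    simp only [mem_iUnion, Metric.mem_ball, exists_prop] at this ⊢
    obtain ⟨y, hy, hxy⟩ := this
    refine ⟨y, hy, (dist_triangle _ (basisProj b (s k) x) _).trans_lt ?_⟩
    have h2 := hx.2 k
    rw [← dist_eq_norm] at h2
    linarith
  · refine IsClosed.isComplete ?_
    rw [Set.ofPred_and, Set.ofPred_forall]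
    refine (isClosed_le continuous_norm continuous_const).inter (isClosed_iInter fun k => ?_)
    exact isClosed_le (continuous_id.sub (continuous_basisProj b (s k))).norm continuous_const

/-- Parseval for the remainder, whose coordinates vanish on `s` and agree with those of `x`
elsewhere. -/
theorem enorm_sub_basisProj_sq [CompleteSpace H] (b : HilbertBasis ι 𝕜 H) (s : Finset ι) (x : H) :
    ‖x - basisProj b s x‖ₑ ^ 2 = ∑' i : {i // i ∉ s}, ‖inner 𝕜 (b i) x‖ₑ ^ 2 := by
  classical
  set y := x - basisProj b s x with hy
  have hin : ∀ i, inner 𝕜 (b i) y = if i ∈ s then 0 else inner 𝕜 (b i) x := by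
    intro i
    rw [hy, inner_sub_right, basisProj, inner_sum]
    simp_rw [inner_smul_right, orthonormal_iff_ite.1 b.orthonormal]
    split_ifs with h <;> simp [h]
  have h1 : HasSum (fun i => ‖inner 𝕜 (b i) y‖ ^ 2) (‖y‖ ^ 2) := by
    have h := b.hasSum_inner_mul_inner y y
    have h2 := RCLike.hasSum_re 𝕜 h
    convert h2 using 1
    · ext i
      rw [← inner_conj_symm y (b i), RCLike.conj_mul]
      norm_cast
    · rw [inner_self_eq_norm_sq]
  have h3 : ‖y‖ₑ ^ 2 = ∑' i, ‖inner 𝕜 (b i) y‖ₑ ^ 2 := by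
    rw [← ofReal_norm, ← ENNReal.ofReal_pow (norm_nonneg _), ← h1.tsum_eq,
      ENNReal.ofReal_tsum_of_nonneg (fun i => by positivity) h1.summable]
    refine tsum_congr fun i => ?_
    rw [← ofReal_norm, ← ENNReal.ofReal_pow (norm_nonneg _)]
  rw [h3, ← tsum_subtype_eq_of_support_subset (s := {i | i ∉ s})]
  · refine tsum_congr fun i => ?_
    rw [hin, if_neg i.2]
  · intro i hi
    by_contra h
    simp only [mem_ofPred_eq, not_not] at h
    simp [hin, h] at hi

/-- Random elements of a Hilbert space whose coordinates in a Hilbert basis have second moments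
bounded by the same summable family are tight. -/
theorem isTightMeasureSet_of_lintegral_inner_sq_le [CompleteSpace H] [SecondCountableTopology H]
    [MeasurableSpace H] [BorelSpace H] {Ω T : Type*} [MeasurableSpace Ω] {P : Measure Ω}
    {S : Set T} {G : T → Ω → H} (hG : ∀ t ∈ S, AEMeasurable (G t) P) (b : HilbertBasis ι 𝕜 H)
    (a : ι → ℝ≥0∞) (ha : ∑' i, a i ≠ ⊤)
    (h : ∀ t ∈ S, ∀ i, ∫⁻ ω, ‖inner 𝕜 (b i) (G t ω)‖ₑ ^ 2 ∂P ≤ a i) :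
    IsTightMeasureSet ((fun t => P.map (G t)) '' S) := by
  have := b.countable_index
  have htail : ∀ t ∈ S, ∀ s : Finset ι,
      ∫⁻ ω, ‖G t ω - basisProj b s (G t ω)‖ₑ ^ 2 ∂P ≤ ∑' i : {i // i ∉ s}, a i := by
    intro t ht s
    simp_rw [enorm_sub_basisProj_sq]
    rw [lintegral_tsum]
    · exact ENNReal.tsum_le_tsum fun i => h t ht i
    · intro i
      have := hG t ht
      have h1 : Measurable fun x : H => ‖inner 𝕜 (b i) x‖ₑ ^ 2 :=
        (Continuous.measurable (by fun_prop))
      exact h1.comp_aemeasurable this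
  rw [isTightMeasureSet_iff_exists_isCompact_measure_compl_le]
  intro δ hδ
  obtain ⟨e, he0, he⟩ := ENNReal.exists_pos_sum_of_countable' (ENNReal.half_pos hδ.ne').ne' ℕ
  let η : ℕ → ℝ := fun k => (1 / 2) ^ k
  have hη : Tendsto η atTop (𝓝 0) := tendsto_pow_atTop_nhds_zero_of_lt_one (by norm_num)
    (by norm_num)
  have hη0 : ∀ k, 0 < η k := fun k => by positivity
  have hηe : ∀ k, ENNReal.ofReal (η k) ^ 2 ≠ 0 := fun k => by simpa using hη0 k
  have hηt : ∀ k, ENNReal.ofReal (η k) ^ 2 ≠ ⊤ := fun k => ENNReal.pow_ne_top ENNReal.ofReal_ne_top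
  -- The tail is chosen so small that Markov's inequality at level `η k` leaves probability at most
  -- `e k`, and the `e k` sum to less than `δ / 2`.
  have hs : ∀ k, ∃ s : Finset ι, ∑' i : {i // i ∉ s}, a i ≤ e k * ENNReal.ofReal (η k) ^ 2 := by
    intro k
    have := (tendsto_order.1 (ENNReal.tendsto_tsum_compl_atTop_zero ha)).2 _
      (pos_iff_ne_zero.2 (mul_ne_zero (he0 k).ne' (hηe k)))
    obtain ⟨s, hs⟩ := this.exists
    exact ⟨s, hs.le⟩
  choose s hs using hs
  obtain ⟨n, hn⟩ := ENNReal.exists_nat_mul_gt (ENNReal.half_pos hδ.ne').ne' ha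
  have hn0 : n ≠ 0 := by
    rintro rfl
    simp at hn
  refine ⟨_, isCompact_of_basisProj b s n η hη, ?_⟩
  rintro _ ⟨t, ht, rfl⟩
  dsimp only
  have hK := (isCompact_of_basisProj b s n η hη).isClosed.measurableSet
  rw [Measure.map_apply_of_aemeasurable (hG t ht) hK.compl]
  have hcover : G t ⁻¹' {x : H | ‖x‖ ≤ n ∧ ∀ k, ‖x - basisProj b (s k) x‖ ≤ η k}ᶜ ⊆
      {ω | (n : ℝ≥0∞) ^ 2 ≤ ‖G t ω‖ₑ ^ 2} ∪
      ⋃ k, {ω | ENNReal.ofReal (η k) ^ 2 ≤ ‖G t ω - basisProj b (s k) (G t ω)‖ₑ ^ 2} := by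
    intro ω hω
    simp only [mem_preimage, mem_compl_iff, mem_ofPred_eq, not_and_or, not_forall, not_le] at hω
    rcases hω with hω | ⟨k, hω⟩
    · left
      simp only [mem_ofPred_eq]
      gcongr
      rw [← ofReal_norm, ← ENNReal.ofReal_natCast]
      exact ENNReal.ofReal_le_ofReal hω.le
    · right
      simp only [mem_iUnion, mem_ofPred_eq]
      refine ⟨k, ?_⟩
      gcongr
      rw [← ofReal_norm]
      exact ENNReal.ofReal_le_ofReal hω.le
  have hm : ∀ s : Finset ι, AEMeasurable (fun ω => ‖G t ω - basisProj b s (G t ω)‖ₑ ^ 2) P := by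
    intro s
    have h1 : Measurable fun x : H => ‖x - basisProj b s x‖ₑ ^ 2 := by
      have := continuous_basisProj b s
      exact Continuous.measurable (by fun_prop)
    exact h1.comp_aemeasurable (hG t ht)
  -- The tail estimate for the empty set bounds the second moment of the whole norm by `∑ a i < n δ
  -- / 2`. Markov divides by `n² ≥ n`.
  have h1 : P {ω | (n : ℝ≥0∞) ^ 2 ≤ ‖G t ω‖ₑ ^ 2} ≤ δ / 2 := by
    have hm0 := hm ∅
    have ht0 := htail t ht ∅
    simp only [basisProj, Finset.sum_empty, sub_zero] at hm0 ht0
    refine (meas_ge_le_lintegral_div hm0 (by simpa using hn0) (by simp)).trans ?_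
    refine ENNReal.div_le_of_le_mul (ht0.trans ?_)
    refine (ENNReal.tsum_comp_le_tsum_of_injective Subtype.val_injective a).trans (hn.le.trans ?_)
    rw [mul_comm]
    gcongr
    norm_cast
    exact Nat.le_self_pow two_ne_zero n
  have h2 : ∀ k, P {ω | ENNReal.ofReal (η k) ^ 2 ≤ ‖G t ω - basisProj b (s k) (G t ω)‖ₑ ^ 2}
      ≤ e k := by
    intro k
    refine (meas_ge_le_lintegral_div (hm (s k)) (hηe k) (hηt k)).trans ?_
    exact ENNReal.div_le_of_le_mul ((htail t ht (s k)).trans (hs k))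
  calc _ ≤ _ := measure_mono hcover
    _ ≤ _ := measure_union_le _ _
    _ ≤ δ / 2 + ∑' k, e k := by
        gcongr
        exact (measure_iUnion_le _).trans (ENNReal.tsum_le_tsum h2)
    _ ≤ δ / 2 + δ / 2 := by gcongr
    _ = δ := ENNReal.add_halves δ

end Tightness

/-! ### The inclusion of `L²` into `H^{-u}` on the Fourier side -/

section L2ToSobolev

open FourierTransform

variable {V : Type*} [NormedAddCommGroup V] [InnerProductSpace ℝ V] [FiniteDimensional ℝ V]
  [MeasurableSpace V] [BorelSpace V]

/-- The inverse Fourier transform of a function in `L¹ ∩ L²` is given by the Fourier integral. -/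
theorem fourierInv_ae_eq (h : Lp ℂ 2 (volume : Measure V)) (hi : Integrable h volume) :
    ⇑(𝓕⁻ h : Lp ℂ 2 (volume : Measure V)) =ᵐ[volume] 𝓕⁻ (⇑h) := by
  have hcont : Continuous (𝓕⁻ (⇑h)) := by
    have : 𝓕⁻ (⇑h) = fun x => 𝓕 (⇑h) (-x) := by
      ext x
      exact Real.fourierInv_eq_fourier_neg _ _
    rw [this]
    exact (VectorFourier.fourierIntegral_continuous Real.continuous_fourierChar
      (innerSL ℝ).continuous₂ hi).comp continuous_neg
  refine ae_eq_of_integral_contDiff_smul_eq ((Lp.memLp _).locallyIntegrable (by norm_num))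
    hcont.locallyIntegrable fun g g_smooth g_cpt => ?_
  have hg₁ : HasCompactSupport (Complex.ofRealCLM ∘ g) := g_cpt.comp_left rfl
  have hg₂ : ContDiff ℝ (⊤ : ℕ∞) (Complex.ofRealCLM ∘ g) := by fun_prop
  set φ : 𝓢(V, ℂ) := hg₁.toSchwartzMap hg₂ with hφ
  -- Both sides are tested against smooth compactly supported functions. The transform is moved onto
  -- the test function by duality of tempered distributions, and moved back onto the integrable
  -- function `h` by Fubini.
  calc ∫ x, g x • (𝓕⁻ h : Lp ℂ 2 (volume : Measure V)) x
      = Lp.toTemperedDistribution (𝓕⁻ h : Lp ℂ 2 (volume : Measure V)) φ := by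
        simp [Lp.toTemperedDistribution_apply, hφ]
    _ = ∫ x, (𝓕⁻ φ) x • h x := by
        rw [← Lp.fourierInv_toTemperedDistribution_eq, fourierInv_apply,
          Lp.toTemperedDistribution_apply]
    _ = ∫ x, (𝓕⁻ (⇑φ)) x • h x := by rw [SchwartzMap.fourierInv_coe]
    _ = ∫ x, φ x • 𝓕⁻ (⇑h) x := by
        have := VectorFourier.integral_fourierIntegral_smul_eq_flip (μ := (volume : Measure V))
          (ν := (volume : Measure V)) (L := -innerₗ V) (f := φ) (g := h)
          Real.continuous_fourierChar (by simpa using! continuous_inner.neg) φ.integrable hi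
        rw [show (-innerₗ V).flip = -innerₗ V by
          ext x y
          simp [real_inner_comm]] at this
        exact this
    _ = ∫ x, g x • 𝓕⁻ (⇑h) x := by simp [hφ]

variable (V) in
/-- The Bessel weight `(1 + ‖ξ‖²)^{-u/2}`. -/
def besselWeight (u : ℝ) (ξ : V) : ℂ := (((1 + ‖ξ‖ ^ 2) ^ (-u / 2) : ℝ) : ℂ)

theorem continuous_besselWeight {V : Type*} [NormedAddCommGroup V] (u : ℝ) :
    Continuous (besselWeight V u) := by
  unfold besselWeight
  refine Complex.continuous_ofReal.comp (Continuous.rpow_const (by fun_prop) fun x => Or.inl ?_)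
  positivity

theorem memLp_top_besselWeight {u : ℝ} (hu : 0 ≤ u) :
    MemLp (besselWeight V u) ⊤ (volume : Measure V) := by
  refine memLp_top_of_bound (continuous_besselWeight u).aestronglyMeasurable 1
    (Eventually.of_forall fun x => ?_)
  rw [besselWeight, Complex.norm_real, Real.norm_eq_abs, abs_of_nonneg (by positivity)]
  exact Real.rpow_le_one_of_one_le_of_nonpos (by simp) (by linarith)

/-- The square of the weight is `(1 + ‖ξ‖²)^{-u}`, integrable because `2u` exceeds the dimension.
This is the origin of the threshold on `u`. -/
theorem memLp_two_besselWeight {u : ℝ} (hu : (Module.finrank ℝ V : ℝ) / 2 < u) :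
    MemLp (besselWeight V u) 2 (volume : Measure V) := by
  rw [memLp_two_iff_integrable_sq_norm (continuous_besselWeight u).aestronglyMeasurable]
  refine (integrable_rpow_neg_one_add_norm_sq (r := 2 * u) (by linarith)).congr
    (Eventually.of_forall fun x => ?_)
  simp only [besselWeight]
  rw [Complex.norm_real, Real.norm_eq_abs, abs_of_nonneg (by positivity), ← Real.rpow_mul_natCast
    (by positivity)]
  congr 1
  push_cast
  ring

namespace SobolevSpace

/-- The inclusion of `L²` into `H^{-u}`, for `u ≥ 0`. -/
def ofL2 (u : ℝ) (hu : 0 ≤ u) (f : Lp ℂ 2 (volume : Measure V)) : SobolevSpace V (-u) :=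
  ⟨Lp.toTemperedDistribution f, MemSobolev.mono (neg_nonpos.2 hu) (memSobolev_zero_iff.2 ⟨f, rfl⟩)⟩

theorem toDistribution_ofL2 (u : ℝ) (hu : 0 ≤ u) (f : Lp ℂ 2 (volume : Measure V)) :
    (ofL2 u hu f).toDistribution = Lp.toTemperedDistribution f := rfl

theorem fourier_toL2_ofL2 (u : ℝ) (hu : 0 ≤ u) (f : Lp ℂ 2 (volume : Measure V)) :
    𝓕 (toL2 (ofL2 u hu f)) = (memLp_top_besselWeight hu).toLp (besselWeight V u) • 𝓕 f := by
  apply lp_toTemperedDistribution_injective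
  have h1 := toL2Fun_spec (ofL2 u hu f)
  rw [toDistribution_ofL2] at h1
  change Lp.toTemperedDistribution (𝓕 (toL2Fun (ofL2 u hu f))) = Lp.toTemperedDistribution _
  rw [← Lp.fourier_toTemperedDistribution_eq]
  rw [Lp.toTemperedDistributionCLM_apply] at h1
  rw [← h1, fourier_besselPotential_eq_smulLeftCLM_fourier_apply,
    Lp.toTemperedDistribution_smul_eq (by unfold besselWeight; fun_prop),
    Lp.fourier_toTemperedDistribution_eq]
  rfl

/-- The Bessel potential of order `-s` provides the preimage. Surjectivity makes `H^s` a copy of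
`L²`, so that compactness can be studied in a Hilbert basis of `L²`. -/
theorem toL2_surjective (s : ℝ) :
    Function.Surjective (toL2 : SobolevSpace V s →ₗ[ℂ] Lp ℂ 2 (volume : Measure V)) := by
  intro g
  have hT : besselPotential V ℂ s (besselPotential V ℂ (-s) (Lp.toTemperedDistribution g)) =
      Lp.toTemperedDistribution g := by simp
  refine ⟨⟨besselPotential V ℂ (-s) (Lp.toTemperedDistribution g), g, hT⟩, ?_⟩
  apply lp_toTemperedDistribution_injective
  refine (toL2Fun_spec (V := V) (s := s) ⟨_, _⟩).symm.trans ?_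
  exact hT

variable (V) in
/-- The isometry `T ↦ (1 + |ξ|²)^{s/2} 𝓕 T` of `H^s` onto `L²`. -/
def fourierL2 (s : ℝ) : SobolevSpace V s ≃ₗᵢ[ℂ] Lp ℂ 2 (volume : Measure V) :=
  (LinearIsometryEquiv.ofSurjective ⟨toL2, fun _ => rfl⟩ (toL2_surjective s)).trans
    (Lp.fourierTransformₗᵢ V ℂ)

theorem fourierL2_ofL2 (u : ℝ) (hu : 0 ≤ u) (f : Lp ℂ 2 (volume : Measure V)) :
    fourierL2 V (-u) (ofL2 u hu f) =
      (memLp_top_besselWeight hu).toLp (besselWeight V u) • 𝓕 f :=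
  fourier_toL2_ofL2 u hu f

/-- Read through the isometry, the map is the Fourier transform followed by multiplication by a
bounded weight. -/
theorem continuous_ofL2 (u : ℝ) (hu : 0 ≤ u) :
    Continuous (ofL2 u hu : Lp ℂ 2 (volume : Measure V) → SobolevSpace V (-u)) := by
  rw [← (fourierL2 V (-u)).comp_continuous_iff]
  change Continuous fun f => fourierL2 V (-u) (ofL2 u hu f)
  simp_rw [fourierL2_ofL2]
  exact ((ContinuousLinearMap.lsmul ℂ ℂ).holderL (volume : Measure V) ⊤ 2 2
    ((memLp_top_besselWeight hu).toLp (besselWeight V u))).continuous.comp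
      (Lp.fourierTransformₗᵢ V ℂ).continuous

end SobolevSpace

end L2ToSobolev

/-! ### Coordinates in `H^{-u}` and tightness from second moments -/

section SobolevTightness

instance {V : Type*} [MeasureSpace V] : MeasurableSpace (Lp ℂ 2 (volume : Measure V)) := borel _

instance {V : Type*} [MeasureSpace V] : BorelSpace (Lp ℂ 2 (volume : Measure V)) := ⟨rfl⟩

instance : Fact ((2 : ℝ≥0∞) ≠ ⊤) := ⟨by norm_num⟩

open FourierTransform

variable {V : Type*} [NormedAddCommGroup V] [InnerProductSpace ℝ V] [FiniteDimensional ℝ V]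
  [MeasurableSpace V] [BorelSpace V]

/-- The function `𝓕⁻ (1 + |ξ|²)^{-u/2} e`, as a Fourier integral. -/
def besselSynthesis (u : ℝ) (e : Lp ℂ 2 (volume : Measure V)) : V → ℂ :=
  𝓕⁻ (fun ξ => besselWeight V u ξ * e ξ)

theorem integrable_besselWeight_mul {u : ℝ} (hu : (Module.finrank ℝ V : ℝ) / 2 < u)
    (e : Lp ℂ 2 (volume : Measure V)) :
    Integrable (fun ξ => besselWeight V u ξ * e ξ) (volume : Measure V) :=
  (memLp_two_besselWeight hu).integrable_mul (Lp.memLp e)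

theorem coeFn_besselWeight_smul {u : ℝ} (hu : 0 ≤ u) (e : Lp ℂ 2 (volume : Measure V)) :
    ⇑((memLp_top_besselWeight hu).toLp (besselWeight V u) • e : Lp ℂ 2 (volume : Measure V))
      =ᵐ[volume] fun ξ => besselWeight V u ξ * e ξ := by
  filter_upwards [Lp.coeFn_lpSMul (r := 2) ((memLp_top_besselWeight hu).toLp (besselWeight V u)) e,
    (memLp_top_besselWeight (V := V) hu).coeFn_toLp] with x h1 h2
  rw [h1, Pi.smul_apply', h2, smul_eq_mul]

/-- The weighted function is a product of two `L²` functions, hence integrable, so its `L²` inverse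
transform has a representative with a value at every point. Bessel's inequality at a fixed point
needs such values. -/
theorem besselSynthesis_ae_eq {u : ℝ} (hu : (Module.finrank ℝ V : ℝ) / 2 < u) (hu0 : 0 ≤ u)
    (e : Lp ℂ 2 (volume : Measure V)) :
    ⇑(𝓕⁻ ((memLp_top_besselWeight hu0).toLp (besselWeight V u) • e : Lp ℂ 2 (volume : Measure V)) :
      Lp ℂ 2 (volume : Measure V)) =ᵐ[volume] besselSynthesis u e := by
  refine (fourierInv_ae_eq _ ((integrable_besselWeight_mul hu e).congr
    (coeFn_besselWeight_smul hu0 e).symm)).trans (Eventually.of_forall fun x => ?_)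
  exact Real.fourierInv_congr_ae (coeFn_besselWeight_smul hu0 e) x

theorem memLp_besselSynthesis {u : ℝ} (hu : (Module.finrank ℝ V : ℝ) / 2 < u) (hu0 : 0 ≤ u)
    (e : Lp ℂ 2 (volume : Measure V)) :
    MemLp (besselSynthesis u e) 2 (volume : Measure V) :=
  (memLp_congr_ae (besselSynthesis_ae_eq hu hu0 e)).1 (Lp.memLp _)

/-- The weight is real, so it moves to the other side of the inner product, and Plancherel then
removes the Fourier transform. A coordinate in `H^{-u}` thus becomes an integral of `f`, whose
second moment is accessible. -/
theorem inner_fourierL2_ofL2 {u : ℝ} (hu : (Module.finrank ℝ V : ℝ) / 2 < u) (hu0 : 0 ≤ u)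
    (e f : Lp ℂ 2 (volume : Measure V)) :
    inner ℂ e (SobolevSpace.fourierL2 V (-u) (SobolevSpace.ofL2 u hu0 f)) =
      ∫ x, f x * (starRingEnd ℂ) (besselSynthesis u e x) := by
  set w := (memLp_top_besselWeight (V := V) hu0).toLp (besselWeight V u) with hw
  have h1 : inner ℂ e (w • 𝓕 f : Lp ℂ 2 (volume : Measure V)) =
      inner ℂ (w • e : Lp ℂ 2 (volume : Measure V)) (𝓕 f) := by
    rw [L2.inner_def, L2.inner_def]
    refine integral_congr_ae ?_
    filter_upwards [coeFn_besselWeight_smul hu0 e, coeFn_besselWeight_smul hu0 (𝓕 f)] with x hx hy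
    rw [hx, hy]
    simp only [RCLike.inner_apply, map_mul, besselWeight, Complex.conj_ofReal]
    ring
  have h2 : 𝓕 (𝓕⁻ (w • e : Lp ℂ 2 (volume : Measure V)) : Lp ℂ 2 (volume : Measure V)) = w • e :=
    FourierTransform.fourier_fourierInv_eq _
  rw [SobolevSpace.fourierL2_ofL2, h1, ← h2, Lp.inner_fourier_eq, L2.inner_def]
  refine integral_congr_ae ?_
  filter_upwards [besselSynthesis_ae_eq hu hu0 e] with x hx
  rw [hx]
  simp [RCLike.inner_apply]

/-- Bessel's inequality for the functions `𝓕⁻ (1 + |ξ|²)^{-u/2} b_i`, at a fixed point. -/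
theorem tsum_enorm_besselSynthesis_sq_le {u : ℝ} (hu : (Module.finrank ℝ V : ℝ) / 2 < u)
    {ι : Type*} (b : HilbertBasis ι ℂ (Lp ℂ 2 (volume : Measure V))) (x : V) :
    ∑' i, ‖besselSynthesis u (b i) x‖ₑ ^ 2 ≤
      ENNReal.ofReal (‖(memLp_two_besselWeight hu).toLp (besselWeight V u)‖ ^ 2) := by
  have hc : Continuous fun ξ : V => ((Real.fourierChar (-inner ℝ ξ x) : Circle) : ℂ) := by
    fun_prop
  have hm : MemLp (fun ξ : V => ((Real.fourierChar (-inner ℝ ξ x) : Circle) : ℂ) *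
      besselWeight V u ξ) 2 (volume : Measure V) := by
    refine (memLp_two_besselWeight hu).congr_norm
      (hc.mul (continuous_besselWeight u)).aestronglyMeasurable (Eventually.of_forall fun ξ => ?_)
    rw [norm_mul, Circle.norm_coe, one_mul]
  have hnorm : ‖hm.toLp‖ = ‖(memLp_two_besselWeight hu).toLp (besselWeight V u)‖ := by
    rw [Lp.norm_toLp, Lp.norm_toLp]
    congr 1
    refine eLpNorm_congr_norm_ae (Eventually.of_forall fun ξ => ?_)
    rw [norm_mul, Circle.norm_coe, one_mul]
  -- Evaluation at `x` is an inner product with the weight modulated by a character. The modulation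
  -- does not change the norm, so the bound is uniform in `x`.
  have hinner : ∀ i, besselSynthesis u (b i) x = inner ℂ (hm.toLp) (b i) := by
    intro i
    rw [besselSynthesis, Real.fourierInv_eq, L2.inner_def]
    refine integral_congr_ae ?_
    filter_upwards [hm.coeFn_toLp] with ξ hξ
    rw [hξ]
    simp only [RCLike.inner_apply, map_mul, besselWeight, Complex.conj_ofReal, Circle.smul_def,
      smul_eq_mul]
    rw [AddChar.map_neg_eq_inv, Circle.coe_inv_eq_conj, Complex.conj_conj]
    ring
  rw [ENNReal.tsum_eq_iSup_sum]
  refine iSup_le fun s => ?_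
  rw [← hnorm]
  refine le_trans (le_of_eq ?_) (ENNReal.ofReal_le_ofReal
    (b.orthonormal.sum_inner_products_le (hm.toLp) (s := s)))
  rw [ENNReal.ofReal_sum_of_nonneg fun i _ => by positivity]
  refine Finset.sum_congr rfl fun i _ => ?_
  rw [hinner, ENNReal.ofReal_pow (norm_nonneg _), ofReal_norm, ← inner_conj_symm, RCLike.enorm_conj]

/-- Tightness of laws is invariant under homeomorphisms. -/
theorem isTightMeasureSet_of_map_homeomorph {A B Ω T : Type*} [TopologicalSpace A]
    [MeasurableSpace A] [BorelSpace A] [T2Space A] [TopologicalSpace B] [MeasurableSpace B]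
    [BorelSpace B] [MeasurableSpace Ω] {P : Measure Ω} (Φ : A ≃ₜ B) {S : Set T} {G : T → Ω → A}
    (hG : ∀ t ∈ S, AEMeasurable (G t) P)
    (h : IsTightMeasureSet ((fun t => P.map (fun ω => Φ (G t ω))) '' S)) :
    IsTightMeasureSet ((fun t => P.map (G t)) '' S) := by
  have := h.map Φ.symm.continuous
  convert this using 1
  rw [image_image]
  refine image_congr fun t ht => ?_
  refine Eq.trans ?_ (AEMeasurable.map_map_of_aemeasurable Φ.symm.continuous.measurable.aemeasurable
    (Φ.continuous.measurable.comp_aemeasurable (hG t ht))).symm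
  congr 1
  ext ω
  simp [Function.comp_def]

/-- A family of random functions whose second moments are dominated by a fixed finite measure is
tight in `H^{-u}`, for `u > d / 2`. -/
theorem isTightMeasureSet_map_ofL2 {u : ℝ} (hu : (Module.finrank ℝ V : ℝ) / 2 < u) (hu0 : 0 ≤ u)
    {Ω T : Type*} [MeasurableSpace Ω] {P : Measure Ω} {S : Set T}
    {G : T → Ω → Lp ℂ 2 (volume : Measure V)} (hG : ∀ t ∈ S, AEMeasurable (G t) P)
    {r : V → ℝ≥0∞} (hr : Measurable r) (hr' : ∫⁻ x, r x ≠ ⊤)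
    (h : ∀ t ∈ S, ∀ f : V → ℂ, MemLp f 2 volume →
      ∫⁻ ω, ‖∫ x, G t ω x * f x‖ₑ ^ 2 ∂P ≤ ∫⁻ x, r x * ‖f x‖ₑ ^ 2) :
    IsTightMeasureSet ((fun t => P.map (fun ω => SobolevSpace.ofL2 u hu0 (G t ω))) '' S) := by
  obtain ⟨s, b, hb⟩ := exists_hilbertBasis ℂ (Lp ℂ 2 (volume : Measure V))
  have := b.countable_index
  have hmeas : ∀ t ∈ S, AEMeasurable (fun ω => SobolevSpace.ofL2 u hu0 (G t ω)) P := fun t ht =>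
    (SobolevSpace.continuous_ofL2 u hu0).measurable.comp_aemeasurable (hG t ht)
  have hΦ := (SobolevSpace.fourierL2 V (-u)).continuous.measurable
  refine isTightMeasureSet_of_map_homeomorph (SobolevSpace.fourierL2 V (-u)).toHomeomorph hmeas ?_
  refine isTightMeasureSet_of_lintegral_inner_sq_le (P := P) (S := S)
    (G := fun t ω => SobolevSpace.fourierL2 V (-u) (SobolevSpace.ofL2 u hu0 (G t ω)))
    (fun t ht => hΦ.comp_aemeasurable (hmeas t ht)) b
    -- Summing over `i` under the integral sign gives at most `∫ r` times the squared `L²` norm of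
    -- the weight.
    (fun i => ∫⁻ x, r x * ‖besselSynthesis u (b i) x‖ₑ ^ 2) ?_ ?_
  · rw [← lintegral_tsum]
    · have hle : ∫⁻ x, ∑' i, r x * ‖besselSynthesis u (b i) x‖ₑ ^ 2 ≤ ∫⁻ x, r x *
          ENNReal.ofReal (‖(memLp_two_besselWeight hu).toLp (besselWeight V u)‖ ^ 2) := by
        refine lintegral_mono fun x => ?_
        rw [ENNReal.tsum_mul_left]
        gcongr
        exact tsum_enorm_besselSynthesis_sq_le hu b x
      refine ne_top_of_le_ne_top ?_ hle
      rw [lintegral_mul_const _ hr]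
      exact ENNReal.mul_ne_top hr' ENNReal.ofReal_ne_top
    · intro i
      exact hr.aemeasurable.mul
        ((memLp_besselSynthesis hu hu0 (b i)).aestronglyMeasurable.enorm.pow_const 2)
  · intro t ht i
    simp_rw [inner_fourierL2_ofL2 hu hu0]
    refine (h t ht _ (memLp_besselSynthesis hu hu0 (b i)).star).trans (le_of_eq ?_)
    simp

end SobolevTightness

/-! ### Exponential moments of Gaussian vectors -/

section Gaussian

variable {Ω : Type*} [MeasurableSpace Ω] {P : Measure Ω}

theorem hasGaussianLaw_integrable_cexp {X : Ω → ℝ} (hX : HasGaussianLaw X P) (z : ℂ) :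
    Integrable (fun ω => Complex.exp (z * X ω)) P := by
  have := hX.isProbabilityMeasure
  have h := hX.map_eq_gaussianReal
  refine integrable_cexp_mul_of_re_mem_integrableExpSet hX.aemeasurable ?_
  have h1 : integrableExpSet id (P.map X) = univ := by
    rw [h]
    exact integrableExpSet_id_gaussianReal
  have h2 : z.re ∈ integrableExpSet id (P.map X) := h1 ▸ mem_univ _
  exact (integrable_map_measure (by fun_prop) hX.aemeasurable).1 h2

theorem integral_cexp_of_hasGaussianLaw {X : Ω → ℝ} (hX : HasGaussianLaw X P)
    (h0 : ∫ ω, X ω ∂P = 0) (z : ℂ) :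
    ∫ ω, Complex.exp (z * X ω) ∂P = Complex.exp (z ^ 2 / 2 * (∫ ω, X ω * X ω ∂P : ℝ)) := by
  have := hX.isProbabilityMeasure
  have h := complexMGF_gaussianReal hX.map_eq_gaussianReal z
  rw [complexMGF] at h
  rw [h, h0, Complex.ofReal_zero, mul_zero, zero_add, Real.coe_toNNReal _ (variance_nonneg _ _),
    variance_eq_integral hX.aemeasurable, h0]
  congr 1
  simp only [sub_zero, pow_two]
  ring

/-- The exponential moments of a centered Gaussian vector in the plane. -/
theorem integral_cexp_add_of_hasGaussianLaw {X Y : Ω → ℝ}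
    (hXY : HasGaussianLaw (fun ω => (X ω, Y ω)) P) (hX0 : ∫ ω, X ω ∂P = 0)
    (hY0 : ∫ ω, Y ω ∂P = 0) (z w : ℂ) :
    Integrable (fun ω => Complex.exp (z * X ω + w * Y ω)) P ∧
    ∫ ω, Complex.exp (z * X ω + w * Y ω) ∂P =
      Complex.exp (z ^ 2 / 2 * (∫ ω, X ω * X ω ∂P : ℝ) + z * w * (∫ ω, X ω * Y ω ∂P : ℝ) +
        w ^ 2 / 2 * (∫ ω, Y ω * Y ω ∂P : ℝ)) := by
  have := hXY.isProbabilityMeasure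
  have hX : HasGaussianLaw X P := hXY.fst
  have hY : HasGaussianLaw Y P := hXY.snd
  set a := ∫ ω, X ω * X ω ∂P with ha
  set m := ∫ ω, X ω * Y ω ∂P with hm
  set c := m / a with hc
  have iXX : Integrable (fun ω => X ω * X ω) P := hX.memLp_two.integrable_mul hX.memLp_two
  have iXY : Integrable (fun ω => X ω * Y ω) P := hX.memLp_two.integrable_mul hY.memLp_two
  have iYY : Integrable (fun ω => Y ω * Y ω) P := hY.memLp_two.integrable_mul hY.memLp_two
  -- If `X` has variance zero, then `c = 0` by the convention for division, and `m = 0` because `X`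
  -- vanishes almost surely.
  have hca : c * a = m := by
    by_cases h : a = 0
    · have : (fun ω => X ω * X ω) =ᵐ[P] 0 :=
        (integral_eq_zero_iff_of_nonneg (fun ω => mul_self_nonneg _) iXX).1 h
      have h2 : (fun ω => X ω * Y ω) =ᵐ[P] 0 := by
        filter_upwards [this] with ω hω
        simp only [Pi.zero_apply, mul_self_eq_zero] at hω
        simp [hω]
      rw [h, mul_zero, hm, integral_congr_ae h2]
      simp
    · rw [hc, div_mul_cancel₀ _ h]
  -- The residual of the regression of `Y` on `X`: uncorrelated with `X`, hence independent of it by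
  -- joint Gaussianity. The exponential moment then factors into two one-dimensional ones.
  let W : Ω → ℝ := fun ω => Y ω - c * X ω
  have hXW : HasGaussianLaw (fun ω => (X ω, W ω)) P :=
    hXY.map_fun ((ContinuousLinearMap.fst ℝ ℝ ℝ).prod
      (ContinuousLinearMap.snd ℝ ℝ ℝ - c • ContinuousLinearMap.fst ℝ ℝ ℝ))
  have hW : HasGaussianLaw W P := hXW.snd
  have hW0 : ∫ ω, W ω ∂P = 0 := by
    simp only [W]
    rw [integral_sub hY.integrable (hX.integrable.const_mul c), integral_const_mul, hX0, hY0]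
    simp
  have hXW0 : ∫ ω, X ω * W ω ∂P = 0 := by
    have : ∀ ω, X ω * W ω = X ω * Y ω - c * (X ω * X ω) := fun ω => by simp only [W]; ring
    simp_rw [this]
    rw [integral_sub iXY (iXX.const_mul c), integral_const_mul, ← ha, ← hm, hca, sub_self]
  have hWW : ∫ ω, W ω * W ω ∂P = ∫ ω, Y ω * Y ω ∂P - c * m := by
    have : ∀ ω, W ω * W ω = Y ω * Y ω - c * (X ω * Y ω) - c * (X ω * W ω) :=
      fun ω => by simp only [W]; ring
    simp_rw [this]
    have iXW : Integrable (fun ω => X ω * W ω) P := hX.memLp_two.integrable_mul hW.memLp_two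
    have i3 : Integrable (fun ω => Y ω * Y ω - c * (X ω * Y ω)) P := iYY.sub (iXY.const_mul c)
    rw [integral_sub i3 (iXW.const_mul c),
      integral_sub iYY (iXY.const_mul c), integral_const_mul, integral_const_mul, hXW0, ← hm]
    simp
  have hind : IndepFun X W P := by
    refine hXW.indepFun_of_covariance_eq_zero ?_
    rw [covariance_eq_sub hX.memLp_two hW.memLp_two, hX0]
    simpa using hXW0
  have hsplit : ∀ ω, Complex.exp (z * X ω + w * Y ω) =
      Complex.exp ((z + w * c) * X ω) * Complex.exp (w * W ω) := by
    intro ω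
    rw [← Complex.exp_add]
    congr 1
    simp only [W]
    push_cast
    ring
  have hind' : IndepFun (fun ω => Complex.exp ((z + w * c) * X ω))
      (fun ω => Complex.exp (w * W ω)) P :=
    hind.comp (φ := fun x : ℝ => Complex.exp ((z + w * c) * x))
      (ψ := fun x : ℝ => Complex.exp (w * x)) (by fun_prop) (by fun_prop)
  have i1 := hasGaussianLaw_integrable_cexp hX (z + w * c)
  have i2 := hasGaussianLaw_integrable_cexp hW w
  simp_rw [hsplit]
  refine ⟨hind'.integrable_mul i1 i2, ?_⟩
  rw [hind'.integral_fun_mul_eq_mul_integral i1.aestronglyMeasurable i2.aestronglyMeasurable,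
    integral_cexp_of_hasGaussianLaw hX hX0, integral_cexp_of_hasGaussianLaw hW hW0,
    ← Complex.exp_add, hWW, ← ha]
  congr 1
  have hca' : (c : ℂ) * a = m := by exact_mod_cast hca
  push_cast
  linear_combination (z * w + w ^ 2 * c / 2) * hca'

end Gaussian

/-! ### Mollified logarithmic kernels -/

section Mollifier

variable {d : ℕ} {θ : Eucl d → ℝ} {ε : ℝ}

theorem IsMollifier.eq_zero (hθ : IsMollifier θ) {x : Eucl d} (hx : 1 < ‖x‖) : θ x = 0 := by
  refine image_eq_zero_of_notMem_tsupport fun h => ?_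
  have := hθ.tsupport_subset h
  rw [mem_closedBall_zero_iff] at this
  linarith

theorem IsMollifier.exists_bound (hθ : IsMollifier θ) : ∃ B, 0 ≤ B ∧ ∀ x, θ x ≤ B := by
  have hc : HasCompactSupport θ :=
    (isCompact_closedBall (0 : Eucl d) 1).of_isClosed_subset (isClosed_tsupport θ)
      hθ.tsupport_subset
  obtain ⟨B, hB⟩ := hc.exists_bound_of_continuous hθ.contDiff.continuous
  exact ⟨B, (norm_nonneg _).trans (hB 0), fun x => (Real.le_norm_self _).trans (hB x)⟩

theorem scaled_nonneg (hθ : IsMollifier θ) (hε : 0 < ε) (x : Eucl d) : 0 ≤ scaled θ ε x :=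
  mul_nonneg (by positivity) (hθ.nonneg _)

theorem continuous_scaled (hθ : IsMollifier θ) (ε : ℝ) : Continuous (scaled θ ε) :=
  continuous_const.mul (hθ.contDiff.continuous.comp (continuous_const_smul _))

theorem scaled_eq_zero (hθ : IsMollifier θ) (hε : 0 < ε) {x : Eucl d} (hx : ε < ‖x‖) :
    scaled θ ε x = 0 := by
  rw [scaled, hθ.eq_zero, mul_zero]
  rw [norm_smul, norm_inv, Real.norm_of_nonneg hε.le, ← div_eq_inv_mul]
  exact (one_lt_div hε).2 hx

/-- A non-integrable function has integral zero by convention, so total mass one forces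
integrability. -/
theorem integrable_mollifier (hθ : IsMollifier θ) : Integrable θ volume := by
  by_contra h
  have := hθ.integral_eq_one
  rw [integral_undef h] at this
  exact zero_ne_one this

theorem integral_scaled (hθ : IsMollifier θ) (hε : 0 < ε) : ∫ x, scaled θ ε x = 1 := by
  simp only [scaled]
  rw [integral_const_mul, Measure.integral_comp_smul, hθ.integral_eq_one]
  simp [abs_of_pos hε]
  field_simp

theorem integrable_scaled (hθ : IsMollifier θ) (hε : 0 < ε) : Integrable (scaled θ ε) volume :=
  ((integrable_mollifier hθ).comp_smul (inv_pos.2 hε).ne').const_mul _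

/-- The positive measure `θ_ε(x - y) dy`. -/
def mollifier (θ : Eucl d → ℝ) (ε : ℝ) (x : Eucl d) : Measure (Eucl d) :=
  volume.withDensity fun y => ENNReal.ofReal (scaled θ ε (x - y))

theorem measurable_scaled_sub (hθ : IsMollifier θ) (ε : ℝ) (x : Eucl d) :
    Measurable fun y => ENNReal.ofReal (scaled θ ε (x - y)) :=
  ((continuous_scaled hθ ε).comp (continuous_const.sub continuous_id)).measurable.ennreal_ofReal

theorem lintegral_scaled_sub (hθ : IsMollifier θ) (hε : 0 < ε) (x : Eucl d) :
    ∫⁻ y, ENNReal.ofReal (scaled θ ε (x - y)) = 1 := by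
  rw [← ofReal_integral_eq_lintegral_ofReal ((integrable_scaled hθ hε).comp_sub_left x)
    (Eventually.of_forall fun y => scaled_nonneg hθ hε _),
    integral_sub_left_eq_self (scaled θ ε) volume x, integral_scaled hθ hε, ENNReal.ofReal_one]

theorem isProbabilityMeasure_mollifier (hθ : IsMollifier θ) (hε : 0 < ε) (x : Eucl d) :
    IsProbabilityMeasure (mollifier θ ε x) :=
  ⟨by rw [mollifier, withDensity_apply _ MeasurableSet.univ, Measure.restrict_univ,
    lintegral_scaled_sub hθ hε]⟩

/-- Seen as a positive measure, the mollifier has a trivial Jordan decomposition, so total variation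
and double integrals reduce to ordinary ones. -/
theorem mollifierMeasure_eq (hθ : IsMollifier θ) (hε : 0 < ε) (x : Eucl d)
    [IsFiniteMeasure (mollifier θ ε x)] :
    mollifierMeasure θ ε x = (mollifier θ ε x).toSignedMeasure := by
  have h := withDensityᵥ_toReal (μ := (volume : Measure (Eucl d)))
    (measurable_scaled_sub hθ ε x).aemeasurable
    (by rw [lintegral_scaled_sub hθ hε]; exact ENNReal.one_ne_top)
  simp_rw [ENNReal.toReal_ofReal (scaled_nonneg hθ hε _)] at h
  exact h

theorem mollifier_ae_norm_le (hθ : IsMollifier θ) (hε : 0 < ε) (x : Eucl d) :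
    ∀ᵐ z ∂(mollifier θ ε x), ‖x - z‖ ≤ ε := by
  rw [mollifier, ae_withDensity_iff (measurable_scaled_sub hθ ε x)]
  refine Eventually.of_forall fun z hz => ?_
  by_contra h
  exact hz (by rw [scaled_eq_zero hθ hε (not_le.1 h), ENNReal.ofReal_zero])

theorem mollifier_absolutelyContinuous (θ : Eucl d → ℝ) (ε : ℝ) (x : Eucl d) :
    mollifier θ ε x ≪ volume :=
  withDensity_absolutelyContinuous _ _

theorem innerDomain_subset (D : Set (Eucl d)) (ε : ℝ) : innerDomain D ε ⊆ D := fun _ h => h.1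

theorem mem_of_mem_innerDomain {D : Set (Eucl d)} (hε : 0 < ε) {x z : Eucl d}
    (hx : x ∈ innerDomain D ε) (hz : ‖x - z‖ ≤ ε) : z ∈ D := by
  by_contra h
  have := hx.2 z h
  linarith

theorem isClosed_innerDomain (D : Set (Eucl d)) (hε : 0 < ε) : IsClosed (innerDomain D ε) := by
  have : innerDomain D ε = ⋂ y ∈ Dᶜ, {x | 2 * ε ≤ ‖x - y‖} := by
    ext x
    simp only [innerDomain, mem_ofPred_eq, mem_iInter, mem_compl_iff]
    -- Membership in `D` is automatic: a point outside `D` could be taken as `y = x`, giving `2 * ε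
    -- ≤ 0`.
    refine ⟨fun h => h.2, fun h => ⟨?_, h⟩⟩
    by_contra hx
    have := h x hx
    simp only [sub_self, norm_zero] at this
    linarith
  rw [this]
  exact isClosed_biInter fun y _ =>
    isClosed_le continuous_const (continuous_id.sub continuous_const).norm

/-! #### Integrals of the logarithm -/

theorem measurable_posLog_norm (a : Eucl d) (ε : ℝ) :
    Measurable fun z : Eucl d => ENNReal.ofReal (Real.posLog (ε / ‖a - z‖)) := by
  unfold Real.posLog
  fun_prop

/-- The function vanishes outside the unit ball and is at most `2 ‖z‖^{-1/2}` inside; the exponent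
`1 / 2 < d` is integrable at the origin. -/
theorem lintegral_posLog_inv_norm_ne_top (hd : 1 ≤ d) :
    ∫⁻ z : Eucl d, ENNReal.ofReal (Real.posLog (1 / ‖z‖)) ≠ ⊤ := by
  have hm : Measurable fun z : Eucl d => Real.posLog (1 / ‖z‖) := by
    unfold Real.posLog
    fun_prop
  have hi : IntegrableOn (fun z : Eucl d => Real.posLog (1 / ‖z‖)) (Metric.ball 0 1) volume := by
    refine integrableOn_ball_of_norm_le_rpow (C := 2) (α := 1 / 2) (by simpa using hd) ?_ ?_
      hm.aestronglyMeasurable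
    · have : (1 : ℝ) ≤ d := by exact_mod_cast hd
      simp only [finrank_euclideanSpace, Fintype.card_fin]
      linarith
    · refine Eventually.of_forall fun z => ?_
      rw [Real.norm_of_nonneg Real.posLog_nonneg, Real.posLog, max_le_iff]
      refine ⟨by positivity, ?_⟩
      refine (Real.log_le_rpow_div (by positivity) (ε := 1 / 2) (by norm_num)).trans (le_of_eq ?_)
      rw [one_div, Real.inv_rpow (norm_nonneg _), ← Real.rpow_neg (norm_nonneg _)]
      ring
  have heq : ∫⁻ z : Eucl d, ENNReal.ofReal (Real.posLog (1 / ‖z‖)) =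
      ∫⁻ z in Metric.ball (0 : Eucl d) 1, ENNReal.ofReal (Real.posLog (1 / ‖z‖)) := by
    rw [← lintegral_indicator measurableSet_ball]
    refine lintegral_congr fun z => ?_
    by_cases hz : z ∈ Metric.ball (0 : Eucl d) 1
    · rw [indicator_of_mem hz]
    · rw [indicator_of_notMem hz]
      rw [mem_ball_zero_iff, not_lt] at hz
      rw [(Real.posLog_eq_zero_iff _).2, ENNReal.ofReal_zero]
      rw [abs_of_nonneg (by positivity)]
      exact div_le_one_of_le₀ hz (norm_nonneg _)
  rw [heq]
  exact hi.lintegral_lt_top.ne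

theorem lintegral_posLog_scale (hε : 0 < ε) (a : Eucl d) :
    ∫⁻ z : Eucl d, ENNReal.ofReal (Real.posLog (ε / ‖a - z‖)) =
      ENNReal.ofReal (ε ^ d) * ∫⁻ z : Eucl d, ENNReal.ofReal (Real.posLog (1 / ‖z‖)) := by
  rw [lintegral_sub_left_eq_self (fun z : Eucl d => ENNReal.ofReal (Real.posLog (ε / ‖z‖))) a]
  have hm : Measurable fun z : Eucl d => ENNReal.ofReal (Real.posLog (1 / ‖z‖)) := by
    unfold Real.posLog
    fun_prop
  have h := Measure.map_addHaar_smul (volume : Measure (Eucl d)) (inv_pos.2 hε).ne'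
  have h2 : ∫⁻ z : Eucl d, ENNReal.ofReal (Real.posLog (ε / ‖z‖)) =
      ∫⁻ z, ENNReal.ofReal (Real.posLog (1 / ‖z‖)) ∂(volume.map (fun z : Eucl d => ε⁻¹ • z)) := by
    rw [lintegral_map hm (measurable_const_smul _)]
    refine lintegral_congr fun z => ?_
    rw [norm_smul, norm_inv, Real.norm_of_nonneg hε.le, ← div_eq_inv_mul, one_div_div]
  rw [h2, h, lintegral_smul_measure]
  simp [abs_of_pos hε]

/-- The mollified logarithm is bounded by `log (1 / ε)`, up to a constant. -/
theorem exists_lintegral_posLog_mollifier_le (hd : 1 ≤ d) (hθ : IsMollifier θ) :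
    ∃ C : ℝ, 0 ≤ C ∧ ∀ ε : ℝ, 0 < ε → ∀ a y : Eucl d,
      ∫⁻ z, ENNReal.ofReal (Real.posLog (ε / ‖a - z‖)) ∂(mollifier θ ε y) ≤ ENNReal.ofReal C := by
  obtain ⟨B, hB0, hB⟩ := hθ.exists_bound
  set I := ∫⁻ z : Eucl d, ENNReal.ofReal (Real.posLog (1 / ‖z‖)) with hI
  refine ⟨B * I.toReal, by positivity, fun ε hε a y => ?_⟩
  rw [mollifier, lintegral_withDensity_eq_lintegral_mul _ (measurable_scaled_sub hθ ε y)
    (measurable_posLog_norm a ε)]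
  -- The density is at most `B ε^{-d}`, and the rescaled integral of the logarithm contributes the
  -- compensating `ε^d`.
  calc _ ≤ ∫⁻ z, ENNReal.ofReal ((ε ^ d)⁻¹ * B) * ENNReal.ofReal (Real.posLog (ε / ‖a - z‖)) := by
        refine lintegral_mono fun z => ?_
        simp only [Pi.mul_apply]
        gcongr
        unfold scaled
        gcongr
        exact hB _
    _ = ENNReal.ofReal ((ε ^ d)⁻¹ * B) * (ENNReal.ofReal (ε ^ d) * I) := by
        rw [lintegral_const_mul _ (measurable_posLog_norm a ε), lintegral_posLog_scale hε]
    _ = ENNReal.ofReal (B * I.toReal) := by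
        rw [← mul_assoc, ← ENNReal.ofReal_mul (by positivity), ENNReal.ofReal_mul hB0,
          ENNReal.ofReal_toReal (lintegral_posLog_inv_norm_ne_top hd)]
        congr 2
        field_simp

end Mollifier

/-! ### Averages of the kernel against pairs of mollifiers -/

section Covariance

variable {d : ℕ} {θ : Eucl d → ℝ} {ε : ℝ}

/-- The Jordan decomposition of a positive measure. -/
def jordanOfMeasure {α : Type*} [MeasurableSpace α] (μ : Measure α) [IsFiniteMeasure μ] :
    JordanDecomposition α where
  posPart := μ
  negPart := 0
  mutuallySingular := Measure.MutuallySingular.zero_right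

theorem toJordanDecomposition_toSignedMeasure {α : Type*} [MeasurableSpace α] (μ : Measure α)
    [IsFiniteMeasure μ] : μ.toSignedMeasure.toJordanDecomposition = jordanOfMeasure μ := by
  refine SignedMeasure.toJordanDecomposition_eq ?_
  simp [JordanDecomposition.toSignedMeasure, jordanOfMeasure]

theorem totalVariation_toSignedMeasure {α : Type*} [MeasurableSpace α] (μ : Measure α)
    [IsFiniteMeasure μ] : μ.toSignedMeasure.totalVariation = μ := by
  rw [SignedMeasure.totalVariation, toJordanDecomposition_toSignedMeasure]
  simp [jordanOfMeasure]

theorem doubleIntegral_toSignedMeasure (k : Eucl d → Eucl d → ℝ) (μ ν : Measure (Eucl d))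
    [IsFiniteMeasure μ] [IsFiniteMeasure ν] :
    doubleIntegral k μ.toSignedMeasure ν.toSignedMeasure =
      ∫ z : Eucl d × Eucl d, k z.1 z.2 ∂(μ.prod ν) := by
  simp [doubleIntegral, toJordanDecomposition_toSignedMeasure, jordanOfMeasure]

theorem measurable_log_norm_sub :
    Measurable fun z : Eucl d × Eucl d => Real.log (1 / ‖z.1 - z.2‖) := by
  fun_prop

theorem prod_mollifier_ae_norm_sub_le (hθ : IsMollifier θ) (hε : 0 < ε) (x y : Eucl d) :
    ∀ᵐ z ∂((mollifier θ ε x).prod (mollifier θ ε y)), ‖x - z.1‖ ≤ ε ∧ ‖y - z.2‖ ≤ ε := by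
  have := isProbabilityMeasure_mollifier hθ hε x
  have := isProbabilityMeasure_mollifier hθ hε y
  have h1 := Measure.quasiMeasurePreserving_fst (μ := mollifier θ ε x) (ν := mollifier θ ε y)
    |>.ae (mollifier_ae_norm_le hθ hε x)
  have h2 := Measure.quasiMeasurePreserving_snd (μ := mollifier θ ε x) (ν := mollifier θ ε y)
    |>.ae (mollifier_ae_norm_le hθ hε y)
  exact h1.and h2

theorem integrable_posLog_mollifier (hd : 1 ≤ d) (hθ : IsMollifier θ) (hε : 0 < ε)
    (x y : Eucl d) :
    Integrable (fun z : Eucl d × Eucl d => Real.posLog (ε / ‖z.1 - z.2‖))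
      ((mollifier θ ε x).prod (mollifier θ ε y)) := by
  have := isProbabilityMeasure_mollifier hθ hε x
  have := isProbabilityMeasure_mollifier hθ hε y
  obtain ⟨C, hC0, hC⟩ := exists_lintegral_posLog_mollifier_le hd hθ
  have hm : Measurable fun z : Eucl d × Eucl d => Real.posLog (ε / ‖z.1 - z.2‖) := by
    unfold Real.posLog
    fun_prop
  refine ⟨hm.aestronglyMeasurable, ?_⟩
  rw [hasFiniteIntegral_iff_ofReal (Eventually.of_forall fun z => Real.posLog_nonneg),
    lintegral_prod _ hm.ennreal_ofReal.aemeasurable]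
  refine (lintegral_mono fun a => hC ε hε a y).trans_lt ?_
  simp

theorem integral_posLog_mollifier_le (hd : 1 ≤ d) (hθ : IsMollifier θ) :
    ∃ C : ℝ, ∀ ε : ℝ, 0 < ε → ∀ x y : Eucl d,
      ∫ z : Eucl d × Eucl d, Real.posLog (ε / ‖z.1 - z.2‖)
        ∂((mollifier θ ε x).prod (mollifier θ ε y)) ≤ C := by
  obtain ⟨C, hC0, hC⟩ := exists_lintegral_posLog_mollifier_le hd hθ
  refine ⟨C, fun ε hε x y => ?_⟩
  have := isProbabilityMeasure_mollifier hθ hε x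
  have := isProbabilityMeasure_mollifier hθ hε y
  have hm : Measurable fun z : Eucl d × Eucl d => Real.posLog (ε / ‖z.1 - z.2‖) := by
    unfold Real.posLog
    fun_prop
  rw [integral_eq_lintegral_of_nonneg_ae (Eventually.of_forall fun z => Real.posLog_nonneg)
    hm.aestronglyMeasurable, lintegral_prod _ hm.ennreal_ofReal.aemeasurable]
  refine ENNReal.toReal_le_of_le_ofReal hC0 ?_
  refine (lintegral_mono fun a => hC ε hε a y).trans ?_
  simp

/-- With `r = |z₁ - z₂|`, `log (1 / r) = log (1 / ε) + log (ε / r)`. The positive part of the last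
term is integrable, and its negative part is at most `r / ε`, bounded because `r ≤ |x - y| + 2ε` on
the supports. -/
theorem integrable_log_mollifier (hd : 1 ≤ d) (hθ : IsMollifier θ) (hε : 0 < ε) (x y : Eucl d) :
    Integrable (fun z : Eucl d × Eucl d => Real.log (1 / ‖z.1 - z.2‖))
      ((mollifier θ ε x).prod (mollifier θ ε y)) := by
  have := isProbabilityMeasure_mollifier hθ hε x
  have := isProbabilityMeasure_mollifier hθ hε y
  refine Integrable.mono' (((integrable_const |Real.log ε|).add
    (integrable_posLog_mollifier hd hθ hε x y)).add
    (integrable_const ((‖x - y‖ + 2 * ε) / ε))) measurable_log_norm_sub.aestronglyMeasurable ?_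
  filter_upwards [prod_mollifier_ae_norm_sub_le hθ hε x y] with z hz
  simp only [Pi.add_apply, Real.norm_eq_abs]
  have hr : ‖z.1 - z.2‖ ≤ ‖x - y‖ + 2 * ε := by
    have : z.1 - z.2 = (x - y) - (x - z.1) + (y - z.2) := by abel
    rw [this]
    have h1 := norm_add_le ((x - y) - (x - z.1)) (y - z.2)
    have h2 := norm_sub_le (x - y) (x - z.1)
    linarith [hz.1, hz.2]
  set r := ‖z.1 - z.2‖ with hrdef
  rcases (norm_nonneg (z.1 - z.2)).eq_or_lt with h0 | h0
  · rw [← hrdef] at h0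
    rw [← h0]
    simp only [div_zero, Real.log_zero, abs_zero]
    have := Real.posLog_nonneg (x := 0)
    positivity
  · rw [← hrdef] at h0
    have h1 : Real.log (1 / r) = -Real.log ε + Real.log (ε / r) := by
      rw [Real.log_div one_ne_zero h0.ne', Real.log_div hε.ne' h0.ne', Real.log_one]
      ring
    have h2 : |Real.log (ε / r)| ≤ Real.posLog (ε / r) + r / ε := by
      rw [abs_le]
      constructor
      · have h3 : Real.log (r / ε) ≤ r / ε := (Real.log_le_sub_one_of_pos (by positivity)).trans
          (by linarith)
        have h4 : Real.log (ε / r) = -Real.log (r / ε) := by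
          rw [← Real.log_inv, inv_div]
        have := Real.posLog_nonneg (x := ε / r)
        linarith
      · have := le_max_right 0 (Real.log (ε / r))
        have h5 : 0 ≤ r / ε := by positivity
        unfold Real.posLog
        linarith
    rw [h1]
    refine (abs_add_le _ _).trans ?_
    rw [abs_neg]
    have : r / ε ≤ (‖x - y‖ + 2 * ε) / ε := by gcongr
    linarith

/-- The mollified logarithm is at most `log (1 / max (ε, |x - y|))`, up to a constant. -/
theorem exists_integral_log_mollifier_le (hd : 1 ≤ d) (hθ : IsMollifier θ) :
    ∃ C : ℝ, ∀ ε ∈ Ioo (0 : ℝ) 1, ∀ x y : Eucl d,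
      ∫ z : Eucl d × Eucl d, Real.log (1 / ‖z.1 - z.2‖)
        ∂((mollifier θ ε x).prod (mollifier θ ε y)) ≤ C + Real.log (1 / max ε ‖x - y‖) := by
  obtain ⟨C, hC⟩ := integral_posLog_mollifier_le hd hθ
  refine ⟨max (C + Real.log 4) (Real.log 2), fun ε hε x y => ?_⟩
  have hε0 : 0 < ε := hε.1
  have := isProbabilityMeasure_mollifier hθ hε0 x
  have := isProbabilityMeasure_mollifier hθ hε0 y
  have hi := integrable_log_mollifier hd hθ hε0 x y
  -- Far apart, moving both points by `ε` at most halves the distance, at the cost of `log 2`. Close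
  -- together, `max ε ‖x - y‖ ≤ 4 * ε`, so `log (1 / ε)` is the right order, at the cost of `log 4`.
  rcases le_or_gt (4 * ε) ‖x - y‖ with hfar | hnear
  · have hxy : 0 < ‖x - y‖ := by linarith
    have hle : ∫ z : Eucl d × Eucl d, Real.log (1 / ‖z.1 - z.2‖)
        ∂((mollifier θ ε x).prod (mollifier θ ε y)) ≤ ∫ z : Eucl d × Eucl d,
          (Real.log 2 + Real.log (1 / ‖x - y‖)) ∂((mollifier θ ε x).prod (mollifier θ ε y)) := by
      refine integral_mono_ae hi (integrable_const _) ?_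
      filter_upwards [prod_mollifier_ae_norm_sub_le hθ hε0 x y] with z hz
      have hr : ‖x - y‖ ≤ 2 * ‖z.1 - z.2‖ := by
        have : x - y = (z.1 - z.2) + (x - z.1) - (y - z.2) := by abel
        have h1 := norm_sub_le ((z.1 - z.2) + (x - z.1)) (y - z.2)
        have h2 := norm_add_le (z.1 - z.2) (x - z.1)
        rw [← this] at h1
        linarith [hz.1, hz.2]
      have hz0 : 0 < ‖z.1 - z.2‖ := by linarith
      rw [← Real.log_mul (by norm_num) (by positivity)]
      refine Real.log_le_log (by positivity) ?_
      rw [mul_one_div, div_le_div_iff₀ hz0 hxy]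
      linarith
    rw [integral_const, probReal_univ, one_smul] at hle
    rw [max_eq_right (by linarith : ε ≤ ‖x - y‖)]
    refine hle.trans ?_
    gcongr
    exact le_max_right _ _
  · have hle : ∫ z : Eucl d × Eucl d, Real.log (1 / ‖z.1 - z.2‖)
        ∂((mollifier θ ε x).prod (mollifier θ ε y)) ≤ ∫ z : Eucl d × Eucl d,
          (Real.log (1 / ε) + Real.posLog (ε / ‖z.1 - z.2‖))
            ∂((mollifier θ ε x).prod (mollifier θ ε y)) := by
      refine integral_mono hi ((integrable_const _).add
        (integrable_posLog_mollifier hd hθ hε0 x y)) fun z => ?_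
      have hlog : 0 ≤ Real.log (1 / ε) :=
        Real.log_nonneg (by rw [le_div_iff₀ hε0]; linarith [hε.2])
      rcases (norm_nonneg (z.1 - z.2)).eq_or_lt with h0 | h0
      · rw [← h0]
        simp only [div_zero, Real.log_zero]
        exact add_nonneg hlog Real.posLog_nonneg
      · have h1 : Real.log (1 / ‖z.1 - z.2‖) = Real.log (1 / ε) + Real.log (ε / ‖z.1 - z.2‖) := by
          rw [← Real.log_mul (by positivity) (by positivity)]
          congr 1
          field_simp
        rw [h1]
        gcongr
        exact le_max_right _ _
    rw [integral_add (integrable_const _) (integrable_posLog_mollifier hd hθ hε0 x y),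
      integral_const, probReal_univ, one_smul] at hle
    have hmax : max ε ‖x - y‖ ≤ 4 * ε := max_le (by linarith) hnear.le
    have hmax0 : 0 < max ε ‖x - y‖ := lt_max_of_lt_left hε0
    have h2 : Real.log (1 / ε) ≤ Real.log 4 + Real.log (1 / max ε ‖x - y‖) := by
      rw [← Real.log_mul (by norm_num) (by positivity)]
      refine Real.log_le_log (by positivity) ?_
      rw [mul_one_div, div_le_div_iff₀ hε0 hmax0]
      linarith
    have h3 := hC ε hε0 x y
    have h4 := le_max_left (C + Real.log 4) (Real.log 2)
    linarith

/-! #### The covariance of the mollified field -/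

variable {D : Set (Eucl d)} {L : Eucl d → Eucl d → ℝ}

/-- Continuity of `L` is known only on `D × D`. Measurability follows because both mollifiers are
carried by `D` when they are centered in `D_ε`. -/
theorem ae_bound_of_continuousOn (hL : ContinuousOn (Function.uncurry L) (D ×ˢ D)) (hD : IsOpen D)
    (hθ : IsMollifier θ) (hε : 0 < ε) {x y : Eucl d} (hx : x ∈ innerDomain D ε)
    (hy : y ∈ innerDomain D ε) {C : ℝ}
    (hC : ∀ z w, ‖x - z‖ ≤ ε → ‖y - w‖ ≤ ε → |L z w| ≤ C) :
    Integrable (fun z : Eucl d × Eucl d => L z.1 z.2)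
      ((mollifier θ ε x).prod (mollifier θ ε y)) ∧
    ∫ z : Eucl d × Eucl d, L z.1 z.2 ∂((mollifier θ ε x).prod (mollifier θ ε y)) ≤ C := by
  have := isProbabilityMeasure_mollifier hθ hε x
  have := isProbabilityMeasure_mollifier hθ hε y
  have hae := prod_mollifier_ae_norm_sub_le hθ hε x y
  have hres : ((mollifier θ ε x).prod (mollifier θ ε y)).restrict (D ×ˢ D) =
      (mollifier θ ε x).prod (mollifier θ ε y) := by
    refine Measure.restrict_eq_self_of_ae_mem ?_
    filter_upwards [hae] with z hz
    exact ⟨mem_of_mem_innerDomain hε hx hz.1, mem_of_mem_innerDomain hε hy hz.2⟩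
  have hmeas : AEStronglyMeasurable (fun z : Eucl d × Eucl d => L z.1 z.2)
      ((mollifier θ ε x).prod (mollifier θ ε y)) := by
    rw [← hres]
    exact hL.aestronglyMeasurable (hD.measurableSet.prod hD.measurableSet)
  have hi : Integrable (fun z : Eucl d × Eucl d => L z.1 z.2)
      ((mollifier θ ε x).prod (mollifier θ ε y)) := by
    refine Integrable.mono' (integrable_const C) hmeas ?_
    filter_upwards [hae] with z hz
    exact hC _ _ hz.1 hz.2
  refine ⟨hi, ?_⟩
  have hle := integral_mono_ae hi (integrable_const C) (by
    filter_upwards [hae] with z hz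
    exact (le_abs_self _).trans (hC _ _ hz.1 hz.2))
  simpa using hle

theorem integrable_logKernel (hd : 1 ≤ d) (hD : IsOpen D) (hL : IsLogCorrelatedKernel D L)
    (hθ : IsMollifier θ) (hε : 0 < ε) {x y : Eucl d} (hx : x ∈ innerDomain D ε)
    (hy : y ∈ innerDomain D ε) :
    Integrable (Function.uncurry (logKernel L))
      ((mollifier θ ε x).prod (mollifier θ ε y)) := by
  have hK : IsCompact (Metric.closedBall x ε ×ˢ Metric.closedBall y ε) :=
    (isCompact_closedBall x ε).prod (isCompact_closedBall y ε)
  have hsub : Metric.closedBall x ε ×ˢ Metric.closedBall y ε ⊆ D ×ˢ D := by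
    refine prod_mono (fun z hz => ?_) fun z hz => ?_
    · exact mem_of_mem_innerDomain hε hx (by
        rwa [mem_closedBall_iff_norm'] at hz)
    · exact mem_of_mem_innerDomain hε hy (by
        rwa [mem_closedBall_iff_norm'] at hz)
  obtain ⟨C, hC⟩ := hK.exists_bound_of_continuousOn (hL.continuousOn.mono hsub)
  have h := (ae_bound_of_continuousOn hL.continuousOn hD hθ hε hx hy (C := C)
    fun z w hz hw => hC (z, w) ⟨mem_closedBall_iff_norm'.2 hz, mem_closedBall_iff_norm'.2 hw⟩).1
  exact h.add (integrable_log_mollifier hd hθ hε x y)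

theorem mollifiedKernel_eq (hθ : IsMollifier θ) (hε : 0 < ε) (x y : Eucl d) :
    mollifiedKernel L θ ε x y = ∫ z : Eucl d × Eucl d, logKernel L z.1 z.2
      ∂((mollifier θ ε x).prod (mollifier θ ε y)) := by
  have hmx := measurable_scaled_sub hθ ε x
  have hmy := measurable_scaled_sub hθ ε y
  have hm : Measurable fun z : Eucl d × Eucl d =>
      ENNReal.ofReal (scaled θ ε (x - z.1)) * ENNReal.ofReal (scaled θ ε (y - z.2)) :=
    (hmx.comp measurable_fst).mul (hmy.comp measurable_snd)
  rw [mollifier, mollifier, prod_withDensity hmx hmy,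
    integral_withDensity_eq_integral_toReal_smul hm
      (Eventually.of_forall fun z => ENNReal.mul_lt_top ENNReal.ofReal_lt_top
        ENNReal.ofReal_lt_top), mollifiedKernel]
  refine integral_congr_ae (Eventually.of_forall fun z => ?_)
  simp [ENNReal.toReal_ofReal (scaled_nonneg hθ hε _)]

end Covariance

/-! ### Uniform covariance bounds and the two-point function -/

section Field

variable {d : ℕ} {θ : Eucl d → ℝ} {ε : ℝ} {D : Set (Eucl d)} {L : Eucl d → Eucl d → ℝ}

/-- The points at distance at most `ε` from `S ∩ D_ε`, for `ε ≤ 1`, stay in a compact subset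
of `D`. -/
theorem exists_isCompact_of_innerDomain (hD : IsOpen D) {S : Set (Eucl d)} (hS : IsCompact S)
    (hSD : S ⊆ D) : ∃ K, IsCompact K ∧ K ⊆ D ∧ ∀ ε ∈ Ioo (0 : ℝ) 1, ∀ x ∈ innerDomain D ε ∩ S,
      ∀ z, ‖x - z‖ ≤ ε → z ∈ K := by
  obtain ⟨δ, hδ, hδD⟩ := hS.exists_cthickening_subset_open hD hSD
  have hcl : IsClosed (innerDomain D (δ / 2)) := isClosed_innerDomain D (half_pos hδ)
  refine ⟨Metric.cthickening δ S ∪ (Metric.cthickening 1 S ∩ innerDomain D (δ / 2)),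
    hS.cthickening.union (hS.cthickening.inter_right hcl),
    union_subset hδD (inter_subset_right.trans (innerDomain_subset D _)), ?_⟩
  intro ε hε x hx z hz
  have hzx : dist z x ≤ ε := by rwa [dist_eq_norm, norm_sub_rev]
  -- For small `ε` the point stays in a thickening of `S` inside `D`. For `ε > δ`, the margin `2ε`
  -- in the definition of `D_ε` leaves `z` at distance at least `ε > δ` from the complement.
  rcases le_or_gt ε δ with h | h
  · left
    exact Metric.mem_cthickening_of_dist_le z x δ S hx.2 (hzx.trans h)
  · right
    refine ⟨Metric.mem_cthickening_of_dist_le z x 1 S hx.2 (hzx.trans hε.2.le),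
      mem_of_mem_innerDomain hε.1 hx.1 hz, fun y hy => ?_⟩
    have h1 := hx.1.2 y hy
    have h2 := norm_add_le (x - z) (z - y)
    rw [sub_add_sub_cancel] at h2
    linarith

/-- One compact subset of `D` contains all the mollifier supports for every `ε < 1`, so the
contribution of `L` is bounded uniformly; the logarithm gives the rest. -/
theorem exists_mollifiedKernel_le (hd : 1 ≤ d) (hD : IsOpen D) (hL : IsLogCorrelatedKernel D L)
    (hθ : IsMollifier θ) {S : Set (Eucl d)} (hS : IsCompact S) (hSD : S ⊆ D) :
    ∃ C : ℝ, ∀ ε ∈ Ioo (0 : ℝ) 1, ∀ x ∈ innerDomain D ε ∩ S, ∀ y ∈ innerDomain D ε ∩ S,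
      mollifiedKernel L θ ε x y ≤ C + Real.log (1 / max ε ‖x - y‖) := by
  obtain ⟨K, hK, hKD, hKS⟩ := exists_isCompact_of_innerDomain hD hS hSD
  obtain ⟨C₁, hC₁⟩ := (hK.prod hK).exists_bound_of_continuousOn
    (hL.continuousOn.mono (prod_mono hKD hKD))
  obtain ⟨C₂, hC₂⟩ := exists_integral_log_mollifier_le hd hθ
  refine ⟨C₁ + C₂, fun ε hε x hx y hy => ?_⟩
  obtain ⟨hi, hle⟩ := ae_bound_of_continuousOn hL.continuousOn hD hθ hε.1 hx.1 hy.1 (C := C₁)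
    fun z w hz hw => hC₁ (z, w) ⟨hKS ε hε x hx z hz, hKS ε hε y hy w hw⟩
  rw [mollifiedKernel_eq hθ hε.1]
  simp only [logKernel]
  rw [integral_add hi (integrable_log_mollifier hd hθ hε.1 x y)]
  have := hC₂ ε hε x y
  linarith

/-- Points are null as `d ≥ 1`, hence so is the diagonal. The infinite value of `|K|` there then
does not affect the energy of a mollifier. -/
theorem prod_mollifier_ae_ne (hd : 1 ≤ d) (hθ : IsMollifier θ) (hε : 0 < ε) (x y : Eucl d) :
    ∀ᵐ z ∂((mollifier θ ε x).prod (mollifier θ ε y)), z.1 ≠ z.2 := by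
  have := isProbabilityMeasure_mollifier hθ hε x
  have := isProbabilityMeasure_mollifier hθ hε y
  have : Nonempty (Fin d) := ⟨⟨0, hd⟩⟩
  have hms : MeasurableSet {z : Eucl d × Eucl d | z.1 ≠ z.2} :=
    (measurableSet_eq_fun measurable_fst measurable_snd).compl
  rw [Measure.ae_prod_iff_ae_ae hms]
  refine Eventually.of_forall fun a => (mollifier_absolutelyContinuous θ ε y).ae_le ?_
  filter_upwards [compl_mem_ae_iff.2 (measure_singleton a)] with b hb
  exact fun h => hb h.symm

theorem mollifierMeasure_mem_finiteEnergy (hd : 1 ≤ d) (hD : IsOpen D)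
    (hL : IsLogCorrelatedKernel D L) (hθ : IsMollifier θ) (hε : 0 < ε) {x : Eucl d}
    (hx : x ∈ innerDomain D ε) : mollifierMeasure θ ε x ∈ finiteEnergy D L := by
  have := isProbabilityMeasure_mollifier hθ hε x
  refine ⟨mollifier θ ε x, 0, inferInstance, inferInstance, ⟨inferInstance, ?_, ?_⟩,
    ⟨inferInstance, by simp, by simp⟩, ?_⟩
  · rw [← mem_ae_iff]
    filter_upwards [mollifier_ae_norm_le hθ hε x] with z hz
    exact mem_of_mem_innerDomain hε hx hz
  · have hi := integrable_logKernel hd hD hL hθ hε hx hx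
    refine lt_of_eq_of_lt (lintegral_congr_ae ?_) hi.2
    filter_upwards [prod_mollifier_ae_ne hd hθ hε x x] with z hz
    rw [absLogKernel, if_neg hz, ← Real.enorm_eq_ofReal_abs]
    rfl
  · rw [mollifierMeasure_eq hθ hε]
    simp

variable {Ω : Type*} [MeasurableSpace Ω] {P : Measure Ω} {X : SignedMeasure (Eucl d) → Ω → ℝ}
  {Xc : ℝ → Eucl d → Ω → ℝ}

/-- The mollified field is a centered Gaussian field whose covariance is the mollified kernel. -/
theorem IsContinuousConvolution.gaussian_pair (hXc : IsContinuousConvolution P D X θ Xc)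
    (hX : IsLogCorrelatedField P D L X) (hd : 1 ≤ d) (hD : IsOpen D)
    (hL : IsLogCorrelatedKernel D L) (hθ : IsMollifier θ) (hε : ε ∈ Ioo (0 : ℝ) 1) {x y : Eucl d}
    (hx : x ∈ innerDomain D ε) (hy : y ∈ innerDomain D ε) :
    HasGaussianLaw (fun ω => (Xc ε x ω, Xc ε y ω)) P ∧ ∫ ω, Xc ε x ω ∂P = 0 ∧
      ∫ ω, Xc ε x ω * Xc ε y ω ∂P = mollifiedKernel L θ ε x y := by
  have := isProbabilityMeasure_mollifier hθ hε.1 x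
  have := isProbabilityMeasure_mollifier hθ hε.1 y
  have hxe := mollifierMeasure_mem_finiteEnergy hd hD hL hθ hε.1 hx
  have hye := mollifierMeasure_mem_finiteEnergy hd hD hL hθ hε.1 hy
  have ex := hXc.version ε hε x hx
  have ey := hXc.version ε hε y hy
  refine ⟨?_, ?_, ?_⟩
  · refine (hX.isGaussianProcess.hasGaussianLaw_prodMk (s := ⟨_, hxe⟩) (t := ⟨_, hye⟩)).congr ?_
    filter_upwards [ex, ey] with ω h1 h2
    rw [h1, h2]
  · rw [integral_congr_ae ex]
    exact hX.centered _ hxe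
  · have h1 : ∫ ω, Xc ε x ω * Xc ε y ω ∂P =
        ∫ ω, X (mollifierMeasure θ ε x) ω * X (mollifierMeasure θ ε y) ω ∂P := by
      refine integral_congr_ae ?_
      filter_upwards [ex, ey] with ω h1 h2
      rw [h1, h2]
    rw [h1, hX.covariance _ hxe _ hye, mollifierMeasure_eq hθ hε.1, mollifierMeasure_eq hθ hε.1,
      doubleIntegral_toSignedMeasure, mollifiedKernel_eq hθ hε.1]
    rw [mollifierMeasure_eq hθ hε.1, mollifierMeasure_eq hθ hε.1, totalVariation_toSignedMeasure,
      totalVariation_toSignedMeasure]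
    exact integrable_logKernel hd hD hL hθ hε.1 hx hy

/-- The two-point function of the complex exponential of the mollified field. -/
theorem IsContinuousConvolution.two_point (hXc : IsContinuousConvolution P D X θ Xc)
    (hX : IsLogCorrelatedField P D L X) (hd : 1 ≤ d) (hD : IsOpen D)
    (hL : IsLogCorrelatedKernel D L) (hθ : IsMollifier θ) (hε : ε ∈ Ioo (0 : ℝ) 1) {x y : Eucl d}
    (hx : x ∈ innerDomain D ε) (hy : y ∈ innerDomain D ε) (γ : ℂ) :
    Integrable (fun ω => Complex.exp (γ * Xc ε x ω - γ ^ 2 / 2 * mollifiedKernel L θ ε x x) *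
      (starRingEnd ℂ) (Complex.exp (γ * Xc ε y ω - γ ^ 2 / 2 * mollifiedKernel L θ ε y y))) P ∧
    ∫ ω, Complex.exp (γ * Xc ε x ω - γ ^ 2 / 2 * mollifiedKernel L θ ε x x) *
      (starRingEnd ℂ) (Complex.exp (γ * Xc ε y ω - γ ^ 2 / 2 * mollifiedKernel L θ ε y y)) ∂P =
      (Real.exp (‖γ‖ ^ 2 * mollifiedKernel L θ ε x y) : ℂ) := by
  obtain ⟨hG, hx0, hxy⟩ := hXc.gaussian_pair hX hd hD hL hθ hε hx hy
  obtain ⟨-, -, hxx⟩ := hXc.gaussian_pair hX hd hD hL hθ hε hx hx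
  obtain ⟨-, hy0, hyy⟩ := hXc.gaussian_pair hX hd hD hL hθ hε hy hy
  obtain ⟨hi, he⟩ := integral_cexp_add_of_hasGaussianLaw hG hx0 hy0 γ ((starRingEnd ℂ) γ)
  rw [hxx, hxy, hyy] at he
  -- This deterministic factor cancels the two diagonal terms of the Gaussian moment taken at `γ`
  -- and its conjugate. Only the cross term, with coefficient `|γ|²`, remains.
  set c := Complex.exp (-(γ ^ 2 / 2 * mollifiedKernel L θ ε x x) -
    (starRingEnd ℂ) γ ^ 2 / 2 * mollifiedKernel L θ ε y y) with hc
  have hsplit : ∀ ω, Complex.exp (γ * Xc ε x ω - γ ^ 2 / 2 * mollifiedKernel L θ ε x x) *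
      (starRingEnd ℂ) (Complex.exp (γ * Xc ε y ω - γ ^ 2 / 2 * mollifiedKernel L θ ε y y)) =
      c * Complex.exp (γ * Xc ε x ω + (starRingEnd ℂ) γ * Xc ε y ω) := by
    intro ω
    rw [← Complex.exp_conj, hc, ← Complex.exp_add, ← Complex.exp_add]
    congr 1
    simp only [map_sub, map_mul, map_div₀, map_pow, Complex.conj_ofReal, map_ofNat]
    ring
  simp_rw [hsplit]
  refine ⟨hi.const_mul c, ?_⟩
  rw [integral_const_mul, he, hc, ← Complex.exp_add, Complex.ofReal_exp]
  congr 1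
  have hn : γ * (starRingEnd ℂ) γ = ((‖γ‖ ^ 2 : ℝ) : ℂ) := by
    rw [Complex.mul_conj, Complex.normSq_eq_norm_sq]
  push_cast at hn ⊢
  rw [← hn]
  ring

end Field

/-! ### Integrals of the truncated power kernel against the normalization -/

section Radial

variable {d : ℕ}

theorem intervalIntegrable_max_rpow {ε : ℝ} (hε : 0 < ε) (q : ℝ) (a b : ℝ) :
    IntervalIntegrable (fun y => (max ε y) ^ q) volume a b := by
  refine Continuous.intervalIntegrable ?_ a b
  refine Continuous.rpow_const (by fun_prop) fun y => Or.inl ?_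
  exact (lt_max_of_lt_left hε).ne'

theorem integral_max_rpow {ε R : ℝ} (hε : 0 < ε) (hR : ε ≤ R) (q : ℝ) :
    ∫ y in (0 : ℝ)..R, (max ε y) ^ q = ε ^ (q + 1) + ∫ y in ε..R, y ^ q := by
  rw [← intervalIntegral.integral_add_adjacent_intervals
    (intervalIntegrable_max_rpow hε q 0 ε) (intervalIntegrable_max_rpow hε q ε R)]
  congr 1
  · have : ∫ y in (0 : ℝ)..ε, (max ε y) ^ q = ∫ y in (0 : ℝ)..ε, ε ^ q := by
      refine intervalIntegral.integral_congr fun y hy => ?_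
      rw [uIcc_of_le hε.le] at hy
      simp only [max_eq_left hy.2]
    rw [this, intervalIntegral.integral_const, sub_zero, smul_eq_mul, Real.rpow_add_one hε.ne',
      mul_comm]
  · refine intervalIntegral.integral_congr fun y hy => ?_
    rw [uIcc_of_le hR] at hy
    simp only [max_eq_right hy.1]

/-- The kernel `max (ε, |z|)^{-p}`, restricted to the ball of radius `R`. -/
def truncKernel (p R ε : ℝ) (z : Eucl d) : ℝ≥0∞ :=
  (Metric.ball (0 : Eucl d) R).indicator (fun z => ENNReal.ofReal ((max ε ‖z‖) ^ (-p))) z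

theorem measurable_truncKernel (p R ε : ℝ) :
    Measurable (truncKernel p R ε : Eucl d → ℝ≥0∞) := by
  unfold truncKernel
  refine Measurable.indicator ?_ measurableSet_ball
  fun_prop

/-- In polar coordinates the Jacobian `y^{d-1}` is at most `max (ε, y)^{d-1}`, so it merges with the
kernel into a single power. -/
theorem lintegral_truncKernel_le (hd : 1 ≤ d) {p R ε : ℝ} (hε : 0 < ε) (hR : ε ≤ R) :
    ∫⁻ z : Eucl d, truncKernel p R ε z ≤
      ENNReal.ofReal (d * volume.real (Metric.ball (0 : Eucl d) 1) *
        ∫ y in (0 : ℝ)..R, (max ε y) ^ ((d : ℝ) - 1 - p)) := by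
  have : Nonempty (Fin d) := ⟨⟨0, hd⟩⟩
  have hR0 : 0 < R := hε.trans_le hR
  let f : ℝ → ℝ := (Iio R).indicator fun y => (max ε y) ^ (-p)
  have hf0 : ∀ y, 0 ≤ f y := fun y => indicator_nonneg (fun y _ => by
    have : 0 < max ε y := lt_max_of_lt_left hε
    positivity) y
  have hfK : ∀ z : Eucl d, truncKernel p R ε z = ENNReal.ofReal (f ‖z‖) := by
    intro z
    by_cases hz : ‖z‖ < R
    · simp [truncKernel, f, hz]
    · simp [truncKernel, f, hz]
  have hmax : Continuous fun y : ℝ => (max ε y) ^ (-p) :=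
    Continuous.rpow_const (by fun_prop) fun y => Or.inl (lt_max_of_lt_left hε).ne'
  have hball : IntegrableOn (fun z : Eucl d => (max ε ‖z‖) ^ (-p)) (Metric.ball 0 R) volume :=
    ((hmax.comp continuous_norm).continuousOn.integrableOn_compact
      (isCompact_closedBall (0 : Eucl d) R)).mono_set Metric.ball_subset_closedBall
  have hint : Integrable (fun z : Eucl d => f ‖z‖) volume := by
    refine (integrable_indicator_iff measurableSet_ball).2 hball |>.congr
      (Eventually.of_forall fun z => ?_)
    by_cases hz : ‖z‖ < R
    · simp [f, hz]
    · simp [f, hz]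
  simp_rw [hfK]
  rw [← ofReal_integral_eq_lintegral_ofReal hint (Eventually.of_forall fun z => hf0 _)]
  refine ENNReal.ofReal_le_ofReal ?_
  rw [integral_fun_norm_addHaar volume f, finrank_euclideanSpace, Fintype.card_fin, nsmul_eq_mul,
    smul_eq_mul, ← mul_assoc]
  gcongr
  rw [intervalIntegral.integral_of_le hR0.le]
  have h1 : ∫ y in Ioi (0 : ℝ), y ^ (d - 1) • f y =
      ∫ y in Ioi (0 : ℝ) ∩ Iio R, y ^ (d - 1) * (max ε y) ^ (-p) := by
    rw [← setIntegral_indicator measurableSet_Iio]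
    refine integral_congr_ae (Eventually.of_forall fun y => ?_)
    by_cases hy : y < R
    · simp [f, hy]
    · simp [f, hy]
  rw [h1, Ioi_inter_Iio, ← integral_Ioc_eq_integral_Ioo]
  refine setIntegral_mono_on ?_ ?_ measurableSet_Ioc fun y hy => ?_
  · exact ((((continuous_pow (d - 1)).mul hmax).continuousOn).integrableOn_compact
      (isCompact_Icc (a := (0 : ℝ)) (b := R))).mono_set Ioc_subset_Icc_self
  · exact (intervalIntegrable_iff_integrableOn_Ioc_of_le hR0.le).1
      (intervalIntegrable_max_rpow hε _ 0 R)
  · have hm : 0 < max ε y := lt_max_of_lt_left hε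
    have h2 : (max ε y) ^ ((d : ℝ) - 1 - p) = (max ε y) ^ (d - 1) * (max ε y) ^ (-p) := by
      rw [← Real.rpow_natCast, ← Real.rpow_add hm, Nat.cast_sub hd]
      congr 1
      push_cast
      ring
    rw [h2]
    have := hy.1.le
    gcongr
    exact le_max_right _ _

/-- The radial integral is at most `ε^{d-p} (1 + 1 / (p - d))` and the squared normalization carries
`ε^{p-d}`. The factor involving `ℓ_θ` is a constant in `ε`, so its value is irrelevant to the bound.
-/
theorem exists_normalization_sq_mul_le_of_lt (hd : 1 ≤ d) (θ : Eucl d → ℝ) {γ : ℂ}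
    (hγ : Real.sqrt d < ‖γ‖) {R : ℝ} (hR : 1 ≤ R) :
    ∃ C : ℝ, ∀ ε ∈ Ioo (0 : ℝ) 1, ENNReal.ofReal (normalization θ γ ε ^ 2) *
      ∫⁻ z : Eucl d, truncKernel (‖γ‖ ^ 2) R ε z ≤ ENNReal.ofReal C := by
  set p := ‖γ‖ ^ 2 with hp
  have hpd : (d : ℝ) < p := (Real.sqrt_lt (Nat.cast_nonneg d) (norm_nonneg _)).1 hγ
  set c := ((1 / 2) * ∫ z : Eucl d, Real.exp (‖γ‖ ^ 2 * ellTheta θ z)) ^ (-(1 / 2) : ℝ) with hc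
  set A := (d : ℝ) * volume.real (Metric.ball (0 : Eucl d) 1) with hA
  refine ⟨c ^ 2 * A * (1 + 1 / (p - d)), fun ε hε => ?_⟩
  have hε0 := hε.1
  have hv : normalization θ γ ε ^ 2 = ε ^ (p - d) * c ^ 2 := by
    rw [normalization, if_pos hγ, mul_pow, ← Real.rpow_mul_natCast hε0.le]
    congr 2
    push_cast
    ring
  have hεR : ε ≤ R := hε.2.le.trans hR
  have hint : ∫ y in (0 : ℝ)..R, (max ε y) ^ ((d : ℝ) - 1 - p) ≤
      ε ^ (-(p - d)) * (1 + 1 / (p - d)) := by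
    rw [integral_max_rpow hε0 hεR, integral_rpow (Or.inr ⟨by linarith, ?_⟩)]
    · have h1 : (d : ℝ) - 1 - p + 1 = -(p - d) := by ring
      rw [h1]
      have h2 : 0 < p - d := by linarith
      have h3 : (R ^ (-(p - d)) - ε ^ (-(p - d))) / (-(p - d)) ≤ ε ^ (-(p - d)) / (p - d) := by
        rw [div_neg, ← neg_div]
        gcongr
        have : 0 ≤ R ^ (-(p - d)) := by positivity
        linarith
      calc _ ≤ _ := add_le_add_right h3 _
        _ = _ := by ring
    · rw [uIcc_of_le hεR]
      exact fun h => absurd h.1 (not_le.2 hε0)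
  calc _ ≤ ENNReal.ofReal (normalization θ γ ε ^ 2) * ENNReal.ofReal (A * _) := by
        gcongr
        exact lintegral_truncKernel_le hd hε0 hεR
    _ = ENNReal.ofReal (normalization θ γ ε ^ 2 *
          (A * ∫ y in (0 : ℝ)..R, (max ε y) ^ ((d : ℝ) - 1 - p))) := by
        rw [← ENNReal.ofReal_mul (sq_nonneg _)]
    _ ≤ _ := by
        refine ENNReal.ofReal_le_ofReal ?_
        rw [hv]
        calc _ ≤ ε ^ (p - d) * c ^ 2 * (A * (ε ^ (-(p - d)) * (1 + 1 / (p - d)))) := by gcongr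
          _ = (ε ^ (p - d) * ε ^ (-(p - d))) * (c ^ 2 * A * (1 + 1 / (p - d))) := by ring
          _ = _ := by rw [← Real.rpow_add hε0, add_neg_cancel, Real.rpow_zero, one_mul]

/-- At `|γ|² = d` the radial integral equals `1 + log R + log (1 / ε)`. Dividing by `log (1 / ε)` is
harmless only away from `ε = 1`, hence the restriction `ε < ε₀`, which keeps the denominator above
`log (1 / ε₀)`. -/
theorem exists_normalization_sq_mul_le (hd : 1 ≤ d) (θ : Eucl d → ℝ) {γ : ℂ}
    (hγ : (d : ℝ) ≤ ‖γ‖ ^ 2) {R : ℝ} (hR : 1 ≤ R) {ε₀ : ℝ} (hε₀ : ε₀ ∈ Ioo (0 : ℝ) 1) :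
    ∃ C : ℝ, ∀ ε ∈ Ioo (0 : ℝ) ε₀, ENNReal.ofReal (normalization θ γ ε ^ 2) *
      ∫⁻ z : Eucl d, truncKernel (‖γ‖ ^ 2) R ε z ≤ ENNReal.ofReal C := by
  by_cases hlt : Real.sqrt d < ‖γ‖
  · obtain ⟨C, hC⟩ := exists_normalization_sq_mul_le_of_lt hd θ hlt hR
    exact ⟨C, fun ε hε => hC ε ⟨hε.1, hε.2.trans hε₀.2⟩⟩
  have hp : ‖γ‖ ^ 2 = d := by
    refine le_antisymm ?_ hγ
    rw [not_lt] at hlt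
    exact (Real.le_sqrt (norm_nonneg _) (Nat.cast_nonneg d)).1 hlt
  set c := Real.pi ^ ((d : ℝ) / 2) / Real.Gamma ((d : ℝ) / 2) with hc
  have hd0 : (0 : ℝ) < d := by exact_mod_cast hd
  have hc0 : 0 < c := div_pos (by positivity) (Real.Gamma_pos_of_pos (by positivity))
  set A := (d : ℝ) * volume.real (Metric.ball (0 : Eucl d) 1) with hA
  set l := Real.log (1 / ε₀) with hl
  have hl0 : 0 < l := Real.log_pos (by rw [lt_div_iff₀ hε₀.1]; linarith [hε₀.2])
  refine ⟨c⁻¹ * A * ((1 + Real.log R) / l + 1), fun ε hε => ?_⟩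
  have hε0 := hε.1
  have hll : l ≤ Real.log (1 / ε) :=
    Real.log_le_log (one_div_pos.2 hε₀.1) (one_div_le_one_div_of_le hε0 hε.2.le)
  have hlε : 0 < Real.log (1 / ε) := hl0.trans_le hll
  have hv : normalization θ γ ε ^ 2 = c⁻¹ * (Real.log (1 / ε))⁻¹ := by
    rw [normalization, if_neg hlt, ← Real.rpow_mul_natCast (by positivity), ← mul_inv, ← hc,
      show (-(1 / 2) : ℝ) * ((2 : ℕ) : ℝ) = -1 by norm_num, Real.rpow_neg_one]
  have hεR : ε ≤ R := (hε.2.trans hε₀.2).le.trans hR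
  have hR0 : 0 < R := by linarith
  have hint : ∫ y in (0 : ℝ)..R, (max ε y) ^ ((d : ℝ) - 1 - ‖γ‖ ^ 2) =
      1 + Real.log R + Real.log (1 / ε) := by
    rw [hp, integral_max_rpow hε0 hεR]
    have h1 : (d : ℝ) - 1 - d = -1 := by ring
    rw [h1]
    simp_rw [Real.rpow_neg_one]
    rw [integral_inv_of_pos hε0 hR0]
    rw [neg_add_cancel, Real.rpow_zero, add_assoc, ← Real.log_mul hR0.ne' (by positivity),
      mul_one_div]
  calc _ ≤ ENNReal.ofReal (normalization θ γ ε ^ 2) * ENNReal.ofReal (A * _) := by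
        gcongr
        exact lintegral_truncKernel_le hd hε0 hεR
    _ = ENNReal.ofReal (normalization θ γ ε ^ 2 *
          (A * ∫ y in (0 : ℝ)..R, (max ε y) ^ ((d : ℝ) - 1 - ‖γ‖ ^ 2))) := by
        rw [← ENNReal.ofReal_mul (sq_nonneg _)]
    _ ≤ _ := by
        refine ENNReal.ofReal_le_ofReal ?_
        rw [hv, hint]
        have hlR : 0 ≤ 1 + Real.log R := by
          have := Real.log_nonneg hR
          linarith
        calc _ = c⁻¹ * A * ((1 + Real.log R) / Real.log (1 / ε) + 1) := by
              field_simp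
          _ ≤ _ := by gcongr

end Radial

/-! ### Random functions -/

section RandomFunctions

variable {Ω : Type*} [MeasurableSpace Ω] {P : Measure Ω}

/-- A field which is almost surely continuous on a measurable set agrees there with a jointly
measurable field. -/
theorem exists_measurable_modification {E : Type*} [MetricSpace E] [SecondCountableTopology E]
    [MeasurableSpace E] [BorelSpace E] {C : Set E} (hC : MeasurableSet C) {Y : E → Ω → ℝ}
    (hm : ∀ x ∈ C, AEMeasurable (Y x) P) (hc : ∀ᵐ ω ∂P, ContinuousOn (fun x => Y x ω) C) :
    ∃ Z : E → Ω → ℝ, Measurable (Function.uncurry Z) ∧ ∀ᵐ ω ∂P, ∀ x ∈ C, Z x ω = Y x ω := by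
  classical
  obtain ⟨S, hSc, hSd⟩ := TopologicalSpace.exists_countable_dense C
  have hver : ∀ᵐ ω ∂P, ∀ q ∈ S, Y q ω = (hm q q.2).mk (Y q) ω :=
    (ae_ball_iff hSc).2 fun q _ => (hm q q.2).ae_eq_mk
  obtain ⟨A, hA, hAm, hAP⟩ := (eventually_iff_exists_mem.1 (hc.and hver)).elim
    fun B hB => (⟨(toMeasurable P Bᶜ)ᶜ, fun ω hω => hB.2 ω (by
      by_contra h
      exact hω (subset_toMeasurable P _ h)), (measurableSet_toMeasurable P _).compl, by
      rw [mem_ae_iff, compl_compl, measure_toMeasurable]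
      exact hB.1⟩ : ∃ A : Set Ω, (∀ ω ∈ A, ContinuousOn (fun x => Y x ω) C ∧
        ∀ q ∈ S, Y q ω = (hm q q.2).mk (Y q) ω) ∧ MeasurableSet A ∧ A ∈ ae P)
  -- Setting the field to zero off the good measurable event makes every path continuous. It is
  -- measurable at the points of `S`, hence at all points of `C` by limits, and path continuity
  -- yields joint measurability.
  let Z' : C → Ω → ℝ := fun q => A.indicator (Y q)
  have hZc : ∀ ω, Continuous fun q => Z' q ω := by
    intro ω
    by_cases hω : ω ∈ A
    · simp only [Z', indicator_of_mem hω]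
      exact continuousOn_iff_continuous_domRestrict.1 (hA ω hω).1
    · simp only [Z', indicator_of_notMem hω]
      exact continuous_const
  have hZS : ∀ q ∈ S, Measurable (Z' q) := by
    intro q hq
    have : Z' q = A.indicator ((hm q q.2).mk (Y q)) := by
      ext ω
      by_cases hω : ω ∈ A
      · simp only [Z', indicator_of_mem hω, (hA ω hω).2 q hq]
      · simp only [Z', indicator_of_notMem hω]
    rw [this]
    exact (hm q q.2).measurable_mk.indicator hAm
  have hZm : ∀ q, Measurable (Z' q) := by
    intro q
    obtain ⟨s, hs, hsq⟩ := mem_closure_iff_seq_limit.1 (hSd q)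
    refine measurable_of_tendsto_metrizable (fun n => hZS (s n) (hs n)) ?_
    rw [tendsto_pi_nhds]
    exact fun ω => ((hZc ω).tendsto q).comp hsq
  have hZ := measurable_uncurry_of_continuous_of_measurable hZc hZm
  refine ⟨fun x ω => if h : x ∈ C then Z' ⟨x, h⟩ ω else 0, ?_, ?_⟩
  · have hs : MeasurableSet {p : E × Ω | p.1 ∈ C} := measurable_fst hC
    refine Measurable.dite (s := {p : E × Ω | p.1 ∈ C})
      (f := fun p => Z' ⟨p.1.1, p.2⟩ p.1.2) (g := fun _ => (0 : ℝ)) ?_ measurable_const hs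
    exact hZ.comp (((measurable_fst.comp measurable_subtype_coe).subtype_mk).prodMk
      (measurable_snd.comp measurable_subtype_coe))
  · filter_upwards [hAP] with ω hω x hx
    simp [hx, Z', hω]

/-- A map into a separable metric space is measurable if its distances to all points are. -/
theorem measurable_of_measurable_edist {H : Type*} [PseudoEMetricSpace H]
    [SecondCountableTopology H] [MeasurableSpace H] [BorelSpace H] {G : Ω → H}
    (h : ∀ c, Measurable fun ω => edist (G ω) c) : Measurable G := by
  refine measurable_of_isOpen fun U hU => ?_
  obtain ⟨T, hT, hTS, hTU⟩ := TopologicalSpace.isOpen_sUnion_countable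
    {B : Set H | ∃ c r, B = Metric.eball c r ∧ B ⊆ U} (by
      rintro B ⟨c, r, rfl, -⟩
      exact Metric.isOpen_eball)
  have hU' : U = ⋃₀ T := by
    rw [hTU]
    refine subset_antisymm (fun x hx => ?_) (sUnion_subset fun B hB => ?_)
    · obtain ⟨r, hr, hrU⟩ := EMetric.isOpen_iff.1 hU x hx
      exact ⟨_, ⟨x, r, rfl, hrU⟩, Metric.mem_eball_self hr⟩
    · obtain ⟨c, r, rfl, hB⟩ := hB
      exact hB
  rw [hU', preimage_sUnion]
  refine MeasurableSet.biUnion hT fun B hB => ?_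
  obtain ⟨c, r, rfl, -⟩ := hTS hB
  exact measurableSet_lt (h c) measurable_const

open Classical in
/-- The class in `L²` of a random function. -/
def randomLp {E : Type*} [MeasureSpace E] (g : E → Ω → ℂ) (ω : Ω) :
    Lp ℂ 2 (volume : Measure E) :=
  if h : MemLp (fun x => g x ω) 2 (volume : Measure E) then h.toLp else 0

theorem coeFn_randomLp {E Ω : Type*} [MeasureSpace E] {g : E → Ω → ℂ} {ω : Ω}
    (h : MemLp (fun x => g x ω) 2 (volume : Measure E)) :
    ⇑(randomLp g ω) =ᵐ[volume] fun x => g x ω := by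
  rw [randomLp, dif_pos h]
  exact h.coeFn_toLp

theorem eLpNorm_two_eq {E : Type*} [MeasurableSpace E] (ν : Measure E) (f : E → ℂ) :
    eLpNorm f 2 ν = (∫⁻ x, ‖f x‖ₑ ^ 2 ∂ν) ^ (1 / 2 : ℝ) := by
  rw [eLpNorm_eq_lintegral_rpow_enorm_toReal (by norm_num) (by norm_num)]
  simp

/-- As `L²` is separable, it suffices that distances to fixed elements be measurable. These are
parametric integrals, measurable by Tonelli, apart from the measurable event on which the class is
set to zero. -/
theorem measurable_randomLp {E : Type*} [MeasureSpace E] [SFinite (volume : Measure E)]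
    [MeasurableSpace.CountablyGenerated E] {g : E → Ω → ℂ}
    (hg : Measurable (Function.uncurry g)) : Measurable (randomLp g) := by
  have hsec : ∀ ω, Measurable fun x => g x ω := fun ω => hg.comp measurable_prodMk_right
  have hmeas : ∀ c : E → ℂ, Measurable c →
      Measurable fun ω => eLpNorm (fun x => g x ω - c x) 2 (volume : Measure E) := by
    intro c hc
    simp_rw [eLpNorm_two_eq]
    refine Measurable.pow_const ?_ _
    have : Measurable fun p : Ω × E => ‖g p.2 p.1 - c p.2‖ₑ ^ 2 :=
      ((hg.comp measurable_swap).sub (hc.comp measurable_snd)).enorm.pow_const 2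
    exact this.lintegral_prod_right'
  have hset : MeasurableSet {ω | MemLp (fun x => g x ω) 2 (volume : Measure E)} := by
    have : {ω | MemLp (fun x => g x ω) 2 (volume : Measure E)} =
        {ω | eLpNorm (fun x => g x ω - 0) 2 (volume : Measure E) < ⊤} := by
      ext ω
      simp only [sub_zero, mem_ofPred_eq]
      exact ⟨fun h => h.2, fun h => ⟨(hsec ω).aestronglyMeasurable, h⟩⟩
    rw [this]
    exact measurableSet_lt (hmeas (fun _ => 0) measurable_const) measurable_const
  refine measurable_of_measurable_edist fun c => ?_
  classical
  obtain ⟨c', hc', hcc'⟩ := (Lp.aestronglyMeasurable c)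
  have heq : (fun ω => edist (randomLp g ω) c) = fun ω =>
      if ω ∈ {ω | MemLp (fun x => g x ω) 2 (volume : Measure E)} then
        eLpNorm (fun x => g x ω - c' x) 2 (volume : Measure E) else edist 0 c := by
    ext ω
    split_ifs with h
    · rw [Lp.edist_def]
      refine eLpNorm_congr_ae ?_
      filter_upwards [coeFn_randomLp h, hcc'] with x h1 h2
      simp only [Pi.sub_apply]
      rw [h1, h2]
    · rw [mem_ofPred_eq] at h
      rw [randomLp, dif_neg h]
  rw [heq]
  exact Measurable.ite hset (hmeas c' hc'.measurable) measurable_const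

theorem mul_le_sq_add_sq (a b : ℝ≥0∞) : a * b ≤ a ^ 2 + b ^ 2 := by
  rcases le_total a b with h | h
  · calc a * b ≤ b * b := by gcongr
      _ ≤ _ := by rw [← sq]; exact le_add_self
  · calc a * b ≤ a * a := by gcongr
      _ ≤ _ := by rw [← sq]; exact le_self_add

theorem lintegral_enorm_sq_eq {h : Ω → ℂ}
    (hi : Integrable (fun ω => h ω * (starRingEnd ℂ) (h ω)) P) :
    ∫⁻ ω, ‖h ω‖ₑ ^ 2 ∂P = ‖∫ ω, h ω * (starRingEnd ℂ) (h ω) ∂P‖ₑ := by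
  simp_rw [Complex.mul_conj, Complex.normSq_eq_norm_sq] at hi ⊢
  have hi' : Integrable (fun ω => ‖h ω‖ ^ 2) P :=
    hi.re.congr (Eventually.of_forall fun ω => Complex.ofReal_re _)
  rw [integral_complex_ofReal, ← ofReal_norm, Complex.norm_real, Real.norm_of_nonneg
    (integral_nonneg fun ω => by positivity), ofReal_integral_eq_lintegral_ofReal hi'
    (Eventually.of_forall fun ω => by positivity)]
  refine lintegral_congr fun ω => ?_
  rw [ENNReal.ofReal_pow (norm_nonneg _), ofReal_norm]

/-- The second moment of the integral of a random function. -/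
theorem lintegral_enorm_integral_mul_sq_le {E : Type*} [MeasurableSpace E] {ν : Measure E}
    [SFinite ν] [SFinite P] {g : E → Ω → ℂ} (hg : Measurable (Function.uncurry g))
    (hg2 : ∫⁻ x, ∫⁻ ω, ‖g x ω‖ₑ ^ 2 ∂P ∂ν ≠ ⊤) {f : E → ℂ} (hfm : Measurable f)
    (hf : ∫⁻ x, ‖f x‖ₑ ^ 2 ∂ν ≠ ⊤) {q : E → E → ℝ≥0∞}
    (hq : ∀ x y, ‖∫ ω, g x ω * (starRingEnd ℂ) (g y ω) ∂P‖ₑ ≤ q x y) :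
    ∫⁻ ω, ‖∫ x, g x ω * f x ∂ν‖ₑ ^ 2 ∂P ≤
      ∫⁻ z : E × E, ‖f z.1‖ₑ * ‖f z.2‖ₑ * q z.1 z.2 ∂(ν.prod ν) := by
  -- The squared modulus of the integral is expanded as a double integral of `F`, so that Fubini
  -- brings the expectation inside, onto the two-point function.
  let F : Ω × (E × E) → ℂ := fun z =>
    (g z.2.1 z.1 * f z.2.1) * (starRingEnd ℂ) (g z.2.2 z.1 * f z.2.2)
  have m1 : Measurable fun z : Ω × (E × E) => g z.2.1 z.1 :=
    hg.comp ((measurable_fst.comp measurable_snd).prodMk measurable_fst)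
  have m2 : Measurable fun z : Ω × (E × E) => g z.2.2 z.1 :=
    hg.comp ((measurable_snd.comp measurable_snd).prodMk measurable_fst)
  have f1 : Measurable fun z : Ω × (E × E) => f z.2.1 :=
    hfm.comp (measurable_fst.comp measurable_snd)
  have f2 : Measurable fun z : Ω × (E × E) => f z.2.2 :=
    hfm.comp (measurable_snd.comp measurable_snd)
  have hFm : Measurable F :=
    (m1.mul f1).mul (Complex.continuous_conj.measurable.comp (m2.mul f2))
  have hg3 : ∫⁻ ω, ∫⁻ x, ‖g x ω‖ₑ ^ 2 ∂ν ∂P ≠ ⊤ := by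
    rw [lintegral_lintegral_swap]
    · exact hg2
    · exact ((hg.comp measurable_swap).enorm.pow_const 2).aemeasurable
  have hFi : Integrable F (P.prod (ν.prod ν)) := by
    refine ⟨hFm.aestronglyMeasurable, ?_⟩
    have hA : Measurable fun z : Ω × (E × E) => ‖g z.2.1 z.1‖ₑ ^ 2 * ‖f z.2.2‖ₑ ^ 2 :=
      (m1.enorm.pow_const 2).mul (f2.enorm.pow_const 2)
    have hB : Measurable fun z : Ω × (E × E) => ‖g z.2.2 z.1‖ₑ ^ 2 * ‖f z.2.1‖ₑ ^ 2 :=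
      (m2.enorm.pow_const 2).mul (f1.enorm.pow_const 2)
    have hgs : ∀ ω, AEMeasurable (fun x => ‖g x ω‖ₑ ^ 2) ν := fun ω =>
      ((hg.comp measurable_prodMk_right).enorm.pow_const 2).aemeasurable
    have hfs : AEMeasurable (fun x => ‖f x‖ₑ ^ 2) ν := (hfm.enorm.pow_const 2).aemeasurable
    have hgo : Measurable fun ω => ∫⁻ x, ‖g x ω‖ₑ ^ 2 ∂ν := by
      have : Measurable fun p : Ω × E => ‖g p.2 p.1‖ₑ ^ 2 :=
        (hg.comp measurable_swap).enorm.pow_const 2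
      exact this.lintegral_prod_right'
    -- The product is regrouped so that each square pairs `g` at one point with `f` at the other;
    -- both terms then have finite integrals that factor.
    have hle : ∀ z, ‖F z‖ₑ ≤ ‖g z.2.1 z.1‖ₑ ^ 2 * ‖f z.2.2‖ₑ ^ 2 +
        ‖g z.2.2 z.1‖ₑ ^ 2 * ‖f z.2.1‖ₑ ^ 2 := by
      intro z
      simp only [F]
      rw [enorm_mul, RCLike.enorm_conj, enorm_mul, enorm_mul, ← mul_pow, ← mul_pow]
      refine le_trans (le_of_eq ?_) (mul_le_sq_add_sq _ _)
      ring
    rw [HasFiniteIntegral]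
    refine (lintegral_mono hle).trans_lt ?_
    rw [lintegral_add_left hA, lintegral_prod _ hA.aemeasurable, lintegral_prod _ hB.aemeasurable]
    have e1 : ∀ ω, ∫⁻ z : E × E, ‖g z.1 ω‖ₑ ^ 2 * ‖f z.2‖ₑ ^ 2 ∂(ν.prod ν) =
        (∫⁻ x, ‖g x ω‖ₑ ^ 2 ∂ν) * ∫⁻ x, ‖f x‖ₑ ^ 2 ∂ν := fun ω =>
      lintegral_prod_mul (hgs ω) hfs
    have e2 : ∀ ω, ∫⁻ z : E × E, ‖g z.2 ω‖ₑ ^ 2 * ‖f z.1‖ₑ ^ 2 ∂(ν.prod ν) =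
        (∫⁻ x, ‖g x ω‖ₑ ^ 2 ∂ν) * ∫⁻ x, ‖f x‖ₑ ^ 2 ∂ν := fun ω => by
      rw [mul_comm, ← lintegral_prod_mul hfs (hgs ω)]
      simp_rw [mul_comm]
    simp only [e1, e2]
    rw [lintegral_mul_const _ hgo]
    exact ENNReal.add_lt_top.2 ⟨ENNReal.mul_lt_top hg3.lt_top hf.lt_top,
      ENNReal.mul_lt_top hg3.lt_top hf.lt_top⟩
  have hI : ∀ ω, ∫ z, F (ω, z) ∂(ν.prod ν) =
      (∫ x, g x ω * f x ∂ν) * (starRingEnd ℂ) (∫ x, g x ω * f x ∂ν) := by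
    intro ω
    simp only [F]
    rw [integral_prod_mul (fun x => g x ω * f x) (fun y => (starRingEnd ℂ) (g y ω * f y)),
      integral_conj]
  have h1 : ∫⁻ ω, ‖∫ x, g x ω * f x ∂ν‖ₑ ^ 2 ∂P = ‖∫ ω, ∫ z, F (ω, z) ∂(ν.prod ν) ∂P‖ₑ := by
    have hint := hFi.integral_prod_left
    simp_rw [hI] at hint ⊢
    exact lintegral_enorm_sq_eq hint
  rw [h1, integral_integral_swap hFi]
  refine (enorm_integral_le_lintegral_enorm _).trans (lintegral_mono fun z => ?_)
  have h2 : ∀ ω, F (ω, z) = (f z.1 * (starRingEnd ℂ) (f z.2)) *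
      (g z.1 ω * (starRingEnd ℂ) (g z.2 ω)) := fun ω => by
    simp only [F, map_mul]
    ring
  simp only [h2]
  rw [integral_const_mul, enorm_mul, enorm_mul, RCLike.enorm_conj]
  gcongr
  exact hq _ _

end RandomFunctions

/-! ### The second moment of the chaos -/

section Chaos

variable {d : ℕ}

/-- Schur's test for a convolution kernel: `a(x) a(y) ≤ a(x)² + a(y)²`, and in each term the free
variable is integrated out by translation invariance. -/
theorem lintegral_mul_truncKernel_le (p R ε : ℝ) {a : Eucl d → ℝ≥0∞} (ha : Measurable a) :
    ∫⁻ z : Eucl d × Eucl d, a z.1 * a z.2 * truncKernel p R ε (z.1 - z.2) ≤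
      2 * (∫⁻ z : Eucl d, truncKernel p R ε z) * ∫⁻ x, a x ^ 2 := by
  have hκ := measurable_truncKernel (d := d) p R ε
  have hκ' : Measurable fun z : Eucl d × Eucl d => truncKernel p R ε (z.1 - z.2) :=
    hκ.comp (measurable_fst.sub measurable_snd)
  have m1 : Measurable fun z : Eucl d × Eucl d => a z.1 ^ 2 * truncKernel p R ε (z.1 - z.2) :=
    ((ha.comp measurable_fst).pow_const 2).mul hκ'
  have m2 : Measurable fun z : Eucl d × Eucl d => a z.2 ^ 2 * truncKernel p R ε (z.1 - z.2) :=
    ((ha.comp measurable_snd).pow_const 2).mul hκ'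
  have e1 : ∫⁻ z : Eucl d × Eucl d, a z.1 ^ 2 * truncKernel p R ε (z.1 - z.2) =
      (∫⁻ z : Eucl d, truncKernel p R ε z) * ∫⁻ x, a x ^ 2 := by
    rw [Measure.volume_eq_prod, lintegral_prod _ m1.aemeasurable]
    simp only
    rw [← lintegral_const_mul _ (ha.pow_const 2)]
    refine lintegral_congr fun x => ?_
    have hx : Measurable fun y => truncKernel p R ε (x - y) :=
      hκ.comp (measurable_const.sub measurable_id)
    rw [lintegral_const_mul _ hx,
      lintegral_sub_left_eq_self (truncKernel p R ε) x, mul_comm]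
  have e2 : ∫⁻ z : Eucl d × Eucl d, a z.2 ^ 2 * truncKernel p R ε (z.1 - z.2) =
      (∫⁻ z : Eucl d, truncKernel p R ε z) * ∫⁻ x, a x ^ 2 := by
    rw [Measure.volume_eq_prod, lintegral_prod_symm _ m2.aemeasurable]
    simp only
    rw [← lintegral_const_mul _ (ha.pow_const 2)]
    refine lintegral_congr fun x => ?_
    have hx : Measurable fun y => truncKernel p R ε (y - x) :=
      hκ.comp (measurable_id.sub measurable_const)
    rw [lintegral_const_mul _ hx,
      lintegral_sub_right_eq_self (truncKernel p R ε) x, mul_comm]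
  calc _ ≤ ∫⁻ z : Eucl d × Eucl d, (a z.1 ^ 2 * truncKernel p R ε (z.1 - z.2) +
        a z.2 ^ 2 * truncKernel p R ε (z.1 - z.2)) := by
        refine lintegral_mono fun z => ?_
        rw [← add_mul]
        gcongr
        exact mul_le_sq_add_sq _ _
    _ = _ := by
        rw [lintegral_add_left m1, e1, e2]
        ring

/-- The density of `φ ↦ v(ε, θ, γ) M_ε^{(γ)}(ρ φ)`, given a realization `Xε` of the field. -/
def gmcDensity (D : Set (Eucl d)) (L : Eucl d → Eucl d → ℝ) (θ : Eucl d → ℝ) (γ : ℂ)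
    (ρ : Eucl d → ℝ) (ε : ℝ) (Xε : Eucl d → ℝ) : Eucl d → ℂ :=
  (innerDomain D ε).indicator fun x => (normalization θ γ ε : ℂ) * ((ρ x : ℂ) *
    Complex.exp (γ * (Xε x : ℂ) - γ ^ 2 / 2 * (mollifiedKernel L θ ε x x : ℂ)))

variable {θ : Eucl d → ℝ} {ε : ℝ} {D : Set (Eucl d)} {L : Eucl d → Eucl d → ℝ} {γ : ℂ}
  {ρ : Eucl d → ℝ}

theorem integral_mul_gmcDensity (hε : 0 < ε) (Xε : Eucl d → ℝ) (φ : Eucl d → ℂ) :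
    ∫ x, φ x * gmcDensity D L θ γ ρ ε Xε x =
      (normalization θ γ ε : ℂ) * gmc D L θ γ ε Xε fun x => (ρ x : ℂ) * φ x := by
  rw [gmc, ← integral_const_mul, ← integral_indicator (isClosed_innerDomain D hε).measurableSet]
  refine integral_congr_ae (Eventually.of_forall fun x => ?_)
  by_cases hx : x ∈ innerDomain D ε
  · simp only [gmcDensity, indicator_of_mem hx]
    ring
  · simp only [gmcDensity, indicator_of_notMem hx, mul_zero]

variable {Ω : Type*} [MeasurableSpace Ω] {P : Measure Ω} {X : SignedMeasure (Eucl d) → Ω → ℝ}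
  {Xc : ℝ → Eucl d → Ω → ℝ}

theorem exists_measurable_gmcDensity [SFinite P] (hXc : IsContinuousConvolution P D X θ Xc)
    (hX : IsLogCorrelatedField P D L X) (hd : 1 ≤ d) (hD : IsOpen D)
    (hL : IsLogCorrelatedKernel D L) (hθ : IsMollifier θ) (hρ : Continuous ρ)
    (hε : ε ∈ Ioo (0 : ℝ) 1) :
    ∃ g : Eucl d → Ω → ℂ, Measurable (Function.uncurry g) ∧
      ∀ᵐ ω ∂P, ∀ x, g x ω = gmcDensity D L θ γ ρ ε (fun x => Xc ε x ω) x := by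
  have hDm := (isClosed_innerDomain D hε.1).measurableSet
  obtain ⟨Z, hZm, hZ⟩ := exists_measurable_modification (P := P) hDm (Y := Xc ε)
    (fun x hx => (hXc.gaussian_pair hX hd hD hL hθ hε hx hx).1.fst.aemeasurable)
    (hXc.continuousOn ε hε)
  -- `K_ε(x, x)` is the variance of the field at `x`; written with `Z`, it is measurable in `x` as a
  -- parametric integral.
  let k : Eucl d → ℝ := fun x => ∫ ω, Z x ω * Z x ω ∂P
  have hk : Measurable k := by
    have : StronglyMeasurable fun p : Eucl d × Ω => Z p.1 p.2 * Z p.1 p.2 :=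
      (hZm.mul hZm).stronglyMeasurable
    exact this.integral_prod_right'.measurable
  have hkK : ∀ x ∈ innerDomain D ε, k x = mollifiedKernel L θ ε x x := by
    intro x hx
    rw [← (hXc.gaussian_pair hX hd hD hL hθ hε hx hx).2.2]
    refine integral_congr_ae ?_
    filter_upwards [hZ] with ω hω
    rw [hω x hx]
  refine ⟨fun x ω => (innerDomain D ε).indicator (fun x => (normalization θ γ ε : ℂ) *
    ((ρ x : ℂ) * Complex.exp (γ * (Z x ω : ℂ) - γ ^ 2 / 2 * (k x : ℂ)))) x, ?_, ?_⟩
  · have h1 : Measurable fun p : Eucl d × Ω => (normalization θ γ ε : ℂ) *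
        ((ρ p.1 : ℂ) * Complex.exp (γ * (Z p.1 p.2 : ℂ) - γ ^ 2 / 2 * (k p.1 : ℂ))) := by
      have hρ' : Measurable fun p : Eucl d × Ω => ρ p.1 := hρ.measurable.comp measurable_fst
      have hk' : Measurable fun p : Eucl d × Ω => k p.1 := hk.comp measurable_fst
      have hZ' : Measurable fun p : Eucl d × Ω => Z p.1 p.2 := hZm
      fun_prop
    exact h1.indicator (measurable_fst hDm)
  · filter_upwards [hZ] with ω hω x
    by_cases hx : x ∈ innerDomain D ε
    · simp only [gmcDensity, indicator_of_mem hx, hω x hx, hkK x hx]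
    · simp only [gmcDensity, indicator_of_notMem hx]

/-- Exponentiating the bound on `K_ε` turns the logarithm into the power `max (ε, |x - y|)^{-|γ|²}`.
The truncation at `R` loses nothing on the support of `ρ`, and elsewhere the density vanishes. -/
theorem gmcDensity_two_point (hXc : IsContinuousConvolution P D X θ Xc)
    (hX : IsLogCorrelatedField P D L X) (hd : 1 ≤ d) (hD : IsOpen D)
    (hL : IsLogCorrelatedKernel D L) (hθ : IsMollifier θ) {C R : ℝ}
    (hε : ε ∈ Ioo (0 : ℝ) 1)
    (hC : ∀ x ∈ innerDomain D ε ∩ tsupport ρ, ∀ y ∈ innerDomain D ε ∩ tsupport ρ,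
      mollifiedKernel L θ ε x y ≤ C + Real.log (1 / max ε ‖x - y‖))
    (hR : ∀ x ∈ tsupport ρ, ∀ y ∈ tsupport ρ, ‖x - y‖ < R) (x y : Eucl d) :
    Integrable (fun ω => gmcDensity D L θ γ ρ ε (fun x => Xc ε x ω) x *
      (starRingEnd ℂ) (gmcDensity D L θ γ ρ ε (fun x => Xc ε x ω) y)) P ∧
    ‖∫ ω, gmcDensity D L θ γ ρ ε (fun x => Xc ε x ω) x *
      (starRingEnd ℂ) (gmcDensity D L θ γ ρ ε (fun x => Xc ε x ω) y) ∂P‖ₑ ≤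
      ENNReal.ofReal (normalization θ γ ε ^ 2) * ENNReal.ofReal (Real.exp (‖γ‖ ^ 2 * C)) *
        (‖ρ x‖ₑ * ‖ρ y‖ₑ * truncKernel (‖γ‖ ^ 2) R ε (x - y)) := by
  by_cases hxy : (x ∈ innerDomain D ε ∧ x ∈ tsupport ρ) ∧ y ∈ innerDomain D ε ∧ y ∈ tsupport ρ
  · obtain ⟨hx, hy⟩ := hxy
    obtain ⟨hi, he⟩ := hXc.two_point hX hd hD hL hθ hε hx.1 hy.1 γ
    set v := normalization θ γ ε with hv
    have hsplit : ∀ ω, gmcDensity D L θ γ ρ ε (fun x => Xc ε x ω) x *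
        (starRingEnd ℂ) (gmcDensity D L θ γ ρ ε (fun x => Xc ε x ω) y) =
        ((v ^ 2 * (ρ x * ρ y) : ℝ) : ℂ) *
        (Complex.exp (γ * Xc ε x ω - γ ^ 2 / 2 * mollifiedKernel L θ ε x x) *
          (starRingEnd ℂ) (Complex.exp (γ * Xc ε y ω - γ ^ 2 / 2 * mollifiedKernel L θ ε y y))) := by
      intro ω
      simp only [gmcDensity, indicator_of_mem hx.1, indicator_of_mem hy.1, map_mul,
        Complex.conj_ofReal]
      push_cast
      ring
    simp_rw [hsplit]
    refine ⟨hi.const_mul _, ?_⟩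
    rw [integral_const_mul, he, ← Complex.ofReal_mul, ← ofReal_norm, Complex.norm_real,
      norm_mul, norm_mul, norm_mul, Real.norm_of_nonneg (sq_nonneg v),
      Real.norm_of_nonneg (Real.exp_pos _).le]
    have hm : 0 < max ε ‖x - y‖ := lt_max_of_lt_left hε.1
    have hexp : Real.exp (‖γ‖ ^ 2 * mollifiedKernel L θ ε x y) ≤
        Real.exp (‖γ‖ ^ 2 * C) * (max ε ‖x - y‖) ^ (-‖γ‖ ^ 2) := by
      rw [Real.rpow_def_of_pos hm, ← Real.exp_add, Real.exp_le_exp]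
      have h1 := mul_le_mul_of_nonneg_left (hC x hx y hy) (sq_nonneg ‖γ‖)
      rw [one_div, Real.log_inv] at h1
      linarith
    have hk : truncKernel (‖γ‖ ^ 2) R ε (x - y) =
        ENNReal.ofReal ((max ε ‖x - y‖) ^ (-‖γ‖ ^ 2)) := by
      rw [truncKernel, indicator_of_mem (mem_ball_zero_iff.2 (hR x hx.2 y hy.2))]
    rw [hk, ← ofReal_norm, ← ofReal_norm, ← ENNReal.ofReal_mul (norm_nonneg _),
      ← ENNReal.ofReal_mul (by positivity), ← ENNReal.ofReal_mul (by positivity),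
      ← ENNReal.ofReal_mul (by positivity)]
    refine ENNReal.ofReal_le_ofReal ?_
    calc _ ≤ v ^ 2 * (‖ρ x‖ * ‖ρ y‖) *
          (Real.exp (‖γ‖ ^ 2 * C) * (max ε ‖x - y‖) ^ (-‖γ‖ ^ 2)) := by gcongr
      _ = _ := by ring
  · have h0 : ∀ z, ¬(z ∈ innerDomain D ε ∧ z ∈ tsupport ρ) → ∀ ω,
        gmcDensity D L θ γ ρ ε (fun x => Xc ε x ω) z = 0 := by
      intro z hz ω
      by_cases h : z ∈ innerDomain D ε
      · have : ρ z = 0 := image_eq_zero_of_notMem_tsupport fun h' => hz ⟨h, h'⟩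
        simp [gmcDensity, this, indicator]
      · simp [gmcDensity, indicator_of_notMem h]
    have hzero : ∀ ω, gmcDensity D L θ γ ρ ε (fun x => Xc ε x ω) x *
        (starRingEnd ℂ) (gmcDensity D L θ γ ρ ε (fun x => Xc ε x ω) y) = 0 := by
      intro ω
      rw [not_and_or] at hxy
      rcases hxy with h | h
      · rw [h0 x h, zero_mul]
      · rw [h0 y h, map_zero, mul_zero]
    simp_rw [hzero]
    simp

end Chaos

/-! ### From the two-point bound to tightness -/

section MainTheorem

variable {d : ℕ} {θ : Eucl d → ℝ} {D : Set (Eucl d)} {L : Eucl d → Eucl d → ℝ} {γ : ℂ}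
  {ρ : Eucl d → ℝ} {Ω : Type*} [MeasurableSpace Ω] {P : Measure Ω}

theorem ae_memLp_of_lintegral_ne_top [SFinite P] {E : Type*} [MeasurableSpace E] {ν : Measure E}
    [SFinite ν] {g : E → Ω → ℂ} (hg : Measurable (Function.uncurry g))
    (hg2 : ∫⁻ x, ∫⁻ ω, ‖g x ω‖ₑ ^ 2 ∂P ∂ν ≠ ⊤) :
    ∀ᵐ ω ∂P, MemLp (fun x => g x ω) 2 ν := by
  have hm : Measurable fun p : Ω × E => ‖g p.2 p.1‖ₑ ^ 2 :=
    (hg.comp measurable_swap).enorm.pow_const 2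
  have hswap : ∫⁻ ω, ∫⁻ x, ‖g x ω‖ₑ ^ 2 ∂ν ∂P ≠ ⊤ := by
    rw [lintegral_lintegral_swap hm.aemeasurable]
    exact hg2
  filter_upwards [ae_lt_top hm.lintegral_prod_right' hswap] with ω hω
  refine ⟨(hg.comp measurable_prodMk_right).aestronglyMeasurable, ?_⟩
  rw [eLpNorm_two_eq]
  exact ENNReal.rpow_lt_top_of_nonneg (by norm_num) hω.ne

/-- Tightness of the normalized chaos over a set of parameters for which the normalization
compensates the divergence of the second moment. -/
theorem isTightMeasureSet_of_two_point [SFinite P] {u : ℝ} (hu : (d : ℝ) / 2 < u) (hu0 : 0 ≤ u)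
    (hρ : Continuous ρ) (hρc : HasCompactSupport ρ) {p R C : ℝ} {v : ℝ → ℝ}
    {g : ℝ → Eucl d → Ω → ℂ} {S : Set ℝ} (hg : ∀ ε ∈ S, Measurable (Function.uncurry (g ε)))
    (hg2 : ∀ ε ∈ S, ∫⁻ x, ∫⁻ ω, ‖g ε x ω‖ₑ ^ 2 ∂P ≠ ⊤)
    (hq : ∀ ε ∈ S, ∀ x y, ‖∫ ω, g ε x ω * (starRingEnd ℂ) (g ε y ω) ∂P‖ₑ ≤
      ENNReal.ofReal (v ε ^ 2) * ENNReal.ofReal (Real.exp (p * C)) *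
        (‖ρ x‖ₑ * ‖ρ y‖ₑ * truncKernel p R ε (x - y)))
    {C' : ℝ} (hv : ∀ ε ∈ S, ENNReal.ofReal (v ε ^ 2) * ∫⁻ z : Eucl d, truncKernel p R ε z ≤
      ENNReal.ofReal C') :
    IsTightMeasureSet
      ((fun ε => P.map (fun ω => SobolevSpace.ofL2 u hu0 (randomLp (g ε) ω))) '' S) := by
  have hρm : Measurable fun x => ‖ρ x‖ₑ := hρ.measurable.enorm
  refine isTightMeasureSet_map_ofL2 (by simpa using hu) hu0
    (fun ε hε => (measurable_randomLp (hg ε hε)).aemeasurable)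
    -- The factor `2` comes from Schur's test, `C'` from the normalization, and `exp (p * C)` from
    -- the constant in the bound on the covariance.
    (r := fun x => 2 * ENNReal.ofReal C' * ENNReal.ofReal (Real.exp (p * C)) * ‖ρ x‖ₑ ^ 2)
    ((hρm.pow_const 2).const_mul _) ?_ ?_
  · rw [lintegral_const_mul _ (hρm.pow_const 2)]
    refine ENNReal.mul_ne_top (by finiteness) ?_
    have h2 : MemLp ρ 2 (volume : Measure (Eucl d)) := hρ.memLp_of_hasCompactSupport hρc
    have := lintegral_rpow_enorm_lt_top_of_eLpNorm_lt_top (by norm_num) (by norm_num) h2.2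
    simpa using this.ne
  · intro ε hε f hf
    -- The second-moment estimate needs a measurable test function, so `f` is replaced by a
    -- representative.
    obtain ⟨f', hf', hff'⟩ := hf.1
    have hfm := hf'.measurable
    have hfρ : Measurable fun x => ‖f' x‖ₑ * ‖ρ x‖ₑ := hfm.enorm.mul hρm
    have hf2 : ∫⁻ x, ‖f' x‖ₑ ^ 2 ≠ ⊤ := by
      have := lintegral_rpow_enorm_lt_top_of_eLpNorm_lt_top (by norm_num) (by norm_num)
        ((memLp_congr_ae hff').1 hf).2
      simpa using this.ne
    have hmem := ae_memLp_of_lintegral_ne_top (hg ε hε) (hg2 ε hε)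
    have h1 : ∫⁻ ω, ‖∫ x, randomLp (g ε) ω x * f x‖ₑ ^ 2 ∂P =
        ∫⁻ ω, ‖∫ x, g ε x ω * f' x‖ₑ ^ 2 ∂P := by
      refine lintegral_congr_ae ?_
      filter_upwards [hmem] with ω hω
      congr 2
      refine integral_congr_ae ?_
      filter_upwards [coeFn_randomLp hω, hff'] with x hx hx'
      rw [hx, hx']
    have h2 : ∫⁻ x, 2 * ENNReal.ofReal C' * ENNReal.ofReal (Real.exp (p * C)) * ‖ρ x‖ₑ ^ 2 *
        ‖f x‖ₑ ^ 2 = 2 * ENNReal.ofReal C' * ENNReal.ofReal (Real.exp (p * C)) *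
          ∫⁻ x, (‖f' x‖ₑ * ‖ρ x‖ₑ) ^ 2 := by
      rw [← lintegral_const_mul _ (hfρ.pow_const 2)]
      refine lintegral_congr_ae ?_
      filter_upwards [hff'] with x hx
      rw [hx]
      ring
    rw [h1, h2]
    refine (lintegral_enorm_integral_mul_sq_le (hg ε hε) (hg2 ε hε) hfm hf2 (hq ε hε)).trans ?_
    have hm : Measurable fun z : Eucl d × Eucl d => (‖f' z.1‖ₑ * ‖ρ z.1‖ₑ) *
        (‖f' z.2‖ₑ * ‖ρ z.2‖ₑ) * truncKernel p R ε (z.1 - z.2) := by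
      have hκ' : Measurable fun z : Eucl d × Eucl d => truncKernel p R ε (z.1 - z.2) :=
        (measurable_truncKernel p R ε).comp (measurable_fst.sub measurable_snd)
      exact ((hfρ.comp measurable_fst).mul (hfρ.comp measurable_snd)).mul hκ'
    calc _ = ENNReal.ofReal (v ε ^ 2) * ENNReal.ofReal (Real.exp (p * C)) *
          ∫⁻ z : Eucl d × Eucl d, (‖f' z.1‖ₑ * ‖ρ z.1‖ₑ) * (‖f' z.2‖ₑ * ‖ρ z.2‖ₑ) *
            truncKernel p R ε (z.1 - z.2) := by
          rw [← lintegral_const_mul _ hm, ← Measure.volume_eq_prod]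
          refine lintegral_congr fun z => ?_
          ring
      _ ≤ ENNReal.ofReal (v ε ^ 2) * ENNReal.ofReal (Real.exp (p * C)) *
          (2 * (∫⁻ z : Eucl d, truncKernel p R ε z) * ∫⁻ x, (‖f' x‖ₑ * ‖ρ x‖ₑ) ^ 2) := by
          gcongr
          exact lintegral_mul_truncKernel_le p R ε hfρ
      _ = 2 * (ENNReal.ofReal (v ε ^ 2) * ∫⁻ z : Eucl d, truncKernel p R ε z) *
          ENNReal.ofReal (Real.exp (p * C)) * ∫⁻ x, (‖f' x‖ₑ * ‖ρ x‖ₑ) ^ 2 := by ring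
      _ ≤ _ := by
          gcongr
          exact hv ε hε

end MainTheorem

end ComplexGMC

end

theorem mainTheorem7 {d : ℕ} {Ω : Type*} [MeasurableSpace Ω] (P : Measure Ω)
    [IsProbabilityMeasure P]
    (D : Set (ComplexGMC.Eucl d)) (hD : IsOpen D)
    (L : ComplexGMC.Eucl d → ComplexGMC.Eucl d → ℝ)
    (hL : ComplexGMC.IsLogCorrelatedKernel D L)
    (s : ℝ) (hs : (d : ℝ) < s)
    (hLs : ComplexGMC.MemSobolevLoc s
      {z : WithLp 2 (ComplexGMC.Eucl d × ComplexGMC.Eucl d) | z.fst ∈ D ∧ z.snd ∈ D}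
      (fun z => L z.fst z.snd))
    (X : SignedMeasure (ComplexGMC.Eucl d) → Ω → ℝ)
    (hX : ComplexGMC.IsLogCorrelatedField P D L X)
    (θ : ComplexGMC.Eucl d → ℝ) (hθ : ComplexGMC.IsMollifier θ)
    (Xc : ℝ → ComplexGMC.Eucl d → Ω → ℝ)
    (hXc : ComplexGMC.IsContinuousConvolution P D X θ Xc)
    (γ : ℂ) (hγ_re : |γ.re| < Real.sqrt ((d : ℝ) / 2)) (hγ : (d : ℝ) ≤ γ.re ^ 2 + γ.im ^ 2)
    (ρ : ComplexGMC.Eucl d → ℝ) (hρ : ComplexGMC.IsTestFunction D ρ)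
    (u : ℝ) (hu : (d : ℝ) / 2 < u) :
    ∃ G : ℝ → Ω → ComplexGMC.SobolevSpace (ComplexGMC.Eucl d) (-u),
      (∀ ε ∈ Ioo (0 : ℝ) 1, AEMeasurable (G ε) P) ∧
      (∀ ε ∈ Ioo (0 : ℝ) 1, ∀ᵐ w ∂P, ∀ φ : 𝓢(ComplexGMC.Eucl d, ℂ),
        (G ε w).toDistribution φ =
          (ComplexGMC.normalization θ γ ε : ℂ) *
            ComplexGMC.gmc D L θ γ ε (fun x => Xc ε x w) (fun x => (ρ x : ℂ) * φ x)) ∧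
      (Real.sqrt d < ‖γ‖ → IsTightMeasureSet ((fun ε => P.map (G ε)) '' Ioo 0 1)) ∧
      (∀ ε₀ ∈ Ioo (0 : ℝ) 1, IsTightMeasureSet ((fun ε => P.map (G ε)) '' Ioo 0 ε₀)) := by
  -- In dimension zero the condition on the real part would read `|γ.re| < 0`.
  have hd : 1 ≤ d := by
    rcases Nat.eq_zero_or_pos d with rfl | h
    · simp only [Nat.cast_zero, zero_div, Real.sqrt_zero] at hγ_re
      exact absurd hγ_re (not_lt.2 (abs_nonneg _))
    · exact h
  have hu0 : 0 ≤ u := (by positivity : (0 : ℝ) ≤ (d : ℝ) / 2).trans hu.le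
  have hγ' : (d : ℝ) ≤ ‖γ‖ ^ 2 := by
    rw [← Complex.normSq_eq_norm_sq, Complex.normSq_apply]
    linarith [hγ, sq γ.re, sq γ.im]
  have hρc : Continuous ρ := hρ.1.continuous
  obtain ⟨C, hC⟩ := ComplexGMC.exists_mollifiedKernel_le hd hD hL hθ hρ.2.1 hρ.2.2
  obtain ⟨R₀, hR₀⟩ := hρ.2.1.isBounded.exists_norm_le
  -- Larger than any distance between points of the support of `ρ`, and at least `1`, so that `ε ≤
  -- R` for every `ε < 1`.
  set R : ℝ := 2 * |R₀| + 1 with hRdef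
  have hR1 : 1 ≤ R := by
    have := abs_nonneg R₀
    linarith
  have hR : ∀ x ∈ tsupport ρ, ∀ y ∈ tsupport ρ, ‖x - y‖ < R := by
    intro x hx y hy
    have h1 := norm_sub_le x y
    have h2 := hR₀ x hx
    have h3 := hR₀ y hy
    have h4 := le_abs_self R₀
    linarith
  have hex : ∀ ε ∈ Ioo (0 : ℝ) 1, ∃ g : ComplexGMC.Eucl d → Ω → ℂ,
      Measurable (Function.uncurry g) ∧
      ∀ᵐ w ∂P, ∀ x, g x w = ComplexGMC.gmcDensity D L θ γ ρ ε (fun x => Xc ε x w) x :=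
    fun ε hε => ComplexGMC.exists_measurable_gmcDensity hXc hX hd hD hL hθ hρc hε
  choose! g hgm hge using hex
  have htp : ∀ ε ∈ Ioo (0 : ℝ) 1, ∀ x y,
      Integrable (fun w => g ε x w * (starRingEnd ℂ) (g ε y w)) P ∧
      ‖∫ w, g ε x w * (starRingEnd ℂ) (g ε y w) ∂P‖ₑ ≤
        ENNReal.ofReal (ComplexGMC.normalization θ γ ε ^ 2) *
          ENNReal.ofReal (Real.exp (‖γ‖ ^ 2 * C)) *
          (‖ρ x‖ₑ * ‖ρ y‖ₑ * ComplexGMC.truncKernel (‖γ‖ ^ 2) R ε (x - y)) := by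
    intro ε hε x y
    obtain ⟨h1, h2⟩ := ComplexGMC.gmcDensity_two_point (γ := γ) hXc hX hd hD hL hθ hε (hC ε hε)
      hR x y
    have he : (fun w => g ε x w * (starRingEnd ℂ) (g ε y w)) =ᵐ[P] fun w =>
        ComplexGMC.gmcDensity D L θ γ ρ ε (fun x => Xc ε x w) x *
          (starRingEnd ℂ) (ComplexGMC.gmcDensity D L θ γ ρ ε (fun x => Xc ε x w) y) := by
      filter_upwards [hge ε hε] with w hw
      rw [hw, hw]
    rw [integral_congr_ae he]
    exact ⟨h1.congr he.symm, h2⟩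
  -- On the diagonal the truncated kernel is finite for each fixed `ε`. This bound is not uniform in
  -- `ε`; it serves only to place the density in `L²` almost surely and to justify Fubini.
  have hg2 : ∀ ε ∈ Ioo (0 : ℝ) 1, ∫⁻ x, ∫⁻ w, ‖g ε x w‖ₑ ^ 2 ∂P ≠ ⊤ := by
    intro ε hε
    have hle : ∀ x, ∫⁻ w, ‖g ε x w‖ₑ ^ 2 ∂P ≤
        ENNReal.ofReal (ComplexGMC.normalization θ γ ε ^ 2) *
          ENNReal.ofReal (Real.exp (‖γ‖ ^ 2 * C)) *
          ComplexGMC.truncKernel (‖γ‖ ^ 2) R ε (0 : ComplexGMC.Eucl d) * ‖ρ x‖ₑ ^ 2 := by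
      intro x
      rw [ComplexGMC.lintegral_enorm_sq_eq (htp ε hε x x).1]
      refine (htp ε hε x x).2.trans (le_of_eq ?_)
      rw [sub_self]
      ring
    refine ne_top_of_le_ne_top ?_ (lintegral_mono hle)
    rw [lintegral_const_mul _ (hρc.measurable.enorm.pow_const 2)]
    have h2 : MemLp ρ 2 (volume : Measure (ComplexGMC.Eucl d)) :=
      hρc.memLp_of_hasCompactSupport hρ.2.1
    have h3 := lintegral_rpow_enorm_lt_top_of_eLpNorm_lt_top (by norm_num) (by norm_num) h2.2
    refine ENNReal.mul_ne_top (ENNReal.mul_ne_top (by finiteness) ?_) (by simpa using h3.ne)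
    unfold ComplexGMC.truncKernel indicator
    split_ifs <;> simp
  refine ⟨fun ε w => ComplexGMC.SobolevSpace.ofL2 u hu0 (ComplexGMC.randomLp (g ε) w), ?_, ?_, ?_,
    ?_⟩
  · intro ε hε
    exact ((ComplexGMC.SobolevSpace.continuous_ofL2 u hu0).measurable.comp
      (ComplexGMC.measurable_randomLp (hgm ε hε))).aemeasurable
  · intro ε hε
    filter_upwards [ComplexGMC.ae_memLp_of_lintegral_ne_top (hgm ε hε) (hg2 ε hε), hge ε hε]
      with w hw hw' φ
    rw [ComplexGMC.SobolevSpace.toDistribution_ofL2, Lp.toTemperedDistribution_apply,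
      ← ComplexGMC.integral_mul_gmcDensity hε.1]
    refine integral_congr_ae ?_
    filter_upwards [ComplexGMC.coeFn_randomLp hw] with x hx
    rw [hx, hw', smul_eq_mul]
  · intro hlt
    obtain ⟨C', hC'⟩ := ComplexGMC.exists_normalization_sq_mul_le_of_lt hd θ hlt hR1
    exact ComplexGMC.isTightMeasureSet_of_two_point hu hu0 hρc hρ.2.1 hgm hg2
      (fun ε hε x y => (htp ε hε x y).2) hC'
  · intro ε₀ hε₀
    have hsub : ∀ ε ∈ Ioo (0 : ℝ) ε₀, ε ∈ Ioo (0 : ℝ) 1 := fun ε hε => ⟨hε.1, hε.2.trans hε₀.2⟩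
    obtain ⟨C', hC'⟩ := ComplexGMC.exists_normalization_sq_mul_le hd θ hγ' hR1 hε₀
    exact ComplexGMC.isTightMeasureSet_of_two_point hu hu0 hρc hρ.2.1
      (fun ε hε => hgm ε (hsub ε hε)) (fun ε hε => hg2 ε (hsub ε hε))
      (fun ε hε x y => (htp ε (hsub ε hε) x y).2) hC'
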